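/- Let $(\Omega,d)$ be a complete separable metric space and $\mu$ a Borel probability measure on it; no curvature or convexity assumption is made. Let $K(r)\in[0,\infty]$ be the log-concentration profile, i.e. the largest function with $1-\mu(A_r)\le e^{-K(r)}$ for every $r\ge 0$ and every Borel set $A$ with $\mu(A)\ge 1/2$, where $A_r=\{x:\exists y\in A,\ d(x,y)<r\}$. For probability measures $\nu$ on $\Omega$ let $W_1(\nu,\mu)=\inf_\pi\int d(x,y)\,d\pi(x,y)\in[0,\infty]$, the infimum being over all couplings $\pi$ of $\nu$ and $\mu$, and let $H(\nu|\mu)=\int\log\frac{d\nu}{d\mu}\,d\nu$ if $\nu\ll\mu$ and $H(\nu|\mu)=+\infty$ otherwise. For $p\ge 1$ let $\varphi_p:[0,\infty)\to[0,\infty)$ be the increasing bijection given by $\varphi_p(x)=x^p/p$ if $p\ge 2$, and, if $1\le p\le 2$, by $\varphi_p(x)=x^2/2$ for $0\le x\le 1$ and $\varphi_p(x)=\frac{x^p}{p}+\frac12-\frac1p$ for $x>1$; put $\varphi_p^{-1}(\infty)=\infty$. For $D\ge 0$ consider the inequalities 1. ($p$-exponential concentration) $K(r)\ge (Dr)^p-1$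 for all $r\ge 0$; 2. (weak $(1,p)$ Transport-Entropy inequality) $D\,W_1(\nu,\mu)\le H(\nu|\mu)^{1/p}+1$ for all probability measures $\nu$; 3. (tight $(1,\varphi_p)$ Transport-Entropy inequality) $D\,W_1(\nu,\mu)\le\varphi_p^{-1}(H(\nu|\mu))$ for all probability measures $\nu$. Let $D_{Con_p}$, $D_{wTE_{1,p}}$, $D_{TE_{1,\varphi_p}}\in[0,\infty]$ be the best constants, i.e. the suprema of all $D\ge0$ for which 1, 2, 3, respectively, hold. Then the three inequalities are equivalent: if one of them holds with some $D>0$, then so does each of the others (with a possibly different $D>0$). Moreover, there are universal constants $c,C>0$, independent of $(\Omega,d,\mu)$ and of $p\ge1$, such that $$c\,D_{wTE_{1,p}}\le D_{Con_p}\le C\,D_{wTE_{1,p}},\qquad c\,D_{TE_{1,\varphi_p}}\le D_{wTE_{1,p}}\le C\,D_{TE_{1,\varphi_p}}.$$ -/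

import Mathlib

open MeasureTheory
open scoped ENNReal NNReal

namespace TransportConcentration

noncomputable section

/-- The log-concentration profile `K(r)` of `(Ω, d, μ)`: the largest extended real `k` such that
`1 - μ(A_r) ≤ exp(-k)` for every Borel set `A` with `μ(A) ≥ 1/2`, where
`A_r = {x | ∃ y ∈ A, d(x, y) < r}` is the open `r`-extension of `A`. -/
def logConcentrationProfile {Ω : Type*} [MetricSpace Ω] [MeasurableSpace Ω]
    (μ : Measure Ω) (r : ℝ) : EReal :=
  sSup {k : EReal | ∀ A : Set Ω, MeasurableSet A → 1 / 2 ≤ μ A →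
    1 - μ (Metric.thickening r A) ≤ EReal.exp (-k)}

/-- The defining supremum is attained, so the profile really is the pointwise maximal function. -/
theorem le_logConcentrationProfile_iff {Ω : Type*} [MetricSpace Ω] [MeasurableSpace Ω]
    (μ : Measure Ω) (r : ℝ) (k : EReal) :
    k ≤ logConcentrationProfile μ r ↔
      ∀ A : Set Ω, MeasurableSet A → 1 / 2 ≤ μ A →
        1 - μ (Metric.thickening r A) ≤ EReal.exp (-k) := by
  have key : ∀ (a : ℝ≥0∞) (k : EReal), a ≤ EReal.exp (-k) ↔ k ≤ -ENNReal.log a := by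
    intro a k
    rw [EReal.le_neg, ← EReal.exp_le_exp_iff, ENNReal.exp_log]
  constructor
  · intro h A hA hA2
    refine (key _ _).2 (h.trans (sSup_le fun k' hk' => (key _ _).1 (hk' A hA hA2)))
  · intro h
    exact le_sSup h

/-- The transportation cost `W_c(ν, μ)`: the infimum of `∫ c dπ` over all probability measures `π`
on `Ω × Ω` with marginals `ν` and `μ`. -/
def transportCost {Ω : Type*} [MeasurableSpace Ω] (c : Ω → Ω → ℝ≥0∞) (ν μ : Measure Ω) : ℝ≥0∞ :=
  ⨅ (π : Measure (Ω × Ω)) (_ : IsProbabilityMeasure π ∧ π.fst = ν ∧ π.snd = μ),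
    ∫⁻ z, c z.1 z.2 ∂π

/-- The Wasserstein distance `W₁`, that is, the transportation cost for the cost function `d`. -/
def wasserstein₁ {Ω : Type*} [MetricSpace Ω] [MeasurableSpace Ω] (ν μ : Measure Ω) : ℝ≥0∞ :=
  transportCost (fun x y => edist x y) ν μ

/-- The convex function `φ_p` on `[0, ∞)`: `x ^ p / p` if `p ≥ 2`; if `1 ≤ p ≤ 2`, it is `x ^ 2 / 2`
on `[0, 1]` and `x ^ p / p + 1 / 2 - 1 / p` on `(1, ∞)`. -/
def phi (p x : ℝ) : ℝ :=
  if 2 ≤ p then x ^ p / p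
  else if x ≤ 1 then x ^ 2 / 2
  else x ^ p / p + 1 / 2 - 1 / p

/-- The inverse of the increasing bijection `φ_p` of `[0, ∞)`, extended by `φ_p⁻¹(∞) = ∞`;
see `phiInv_phi`, `exists_phi_eq` and `phiInv_top`. -/
def phiInv (p : ℝ) (h : ℝ≥0∞) : ℝ≥0∞ :=
  ⨆ (x : ℝ≥0) (_ : ENNReal.ofReal (phi p x) ≤ h), (x : ℝ≥0∞)

theorem phi_zero {p : ℝ} (hp : 1 ≤ p) : phi p 0 = 0 := by
  have : p ≠ 0 := by positivity
  unfold phi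
  split_ifs <;> simp_all [Real.zero_rpow]

theorem phi_lt_phi {p : ℝ} (hp : 1 ≤ p) {x y : ℝ} (hx : 0 ≤ x) (hxy : x < y) :
    phi p x < phi p y := by
  have hp0 : 0 < p := by linarith
  have hpow : ∀ {a b : ℝ}, 0 ≤ a → a < b → a ^ p / p < b ^ p / p := fun ha hab =>
    div_lt_div_of_pos_right (Real.rpow_lt_rpow ha hab hp0) hp0
  unfold phi
  split_ifs with h2 h3 h4 h4
  · exact hpow hx hxy
  · nlinarith
  · have h1 := hpow zero_le_one (not_le.1 h4)
    rw [Real.one_rpow] at h1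
    nlinarith
  · linarith
  · linarith [hpow hx hxy]

theorem phi_nonneg {p : ℝ} (hp : 1 ≤ p) {x : ℝ} (hx : 0 ≤ x) : 0 ≤ phi p x := by
  rcases hx.eq_or_lt with rfl | hx
  · exact (phi_zero hp).ge
  · exact (phi_zero hp).ge.trans (phi_lt_phi hp le_rfl hx).le

theorem phiInv_phi {p : ℝ} (hp : 1 ≤ p) (x : ℝ≥0) :
    phiInv p (ENNReal.ofReal (phi p x)) = x := by
  refine le_antisymm (iSup₂_le fun y hy => ?_) (le_iSup₂_of_le x le_rfl le_rfl)
  by_contra hlt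
  have hlt : x < y := by simpa using hlt
  have h1 := phi_lt_phi hp x.2 (NNReal.coe_lt_coe.2 hlt)
  have h2 := (ENNReal.ofReal_le_ofReal_iff (phi_nonneg hp x.2)).1 hy
  exact absurd h2 (not_le.2 h1)

theorem exists_phi_eq {p : ℝ} (hp : 1 ≤ p) (h : ℝ≥0) : ∃ x : ℝ≥0, phi p x = h := by
  have hp0 : 0 < p := by linarith
  have hroot : ∀ a : ℝ, 0 ≤ a → 0 ≤ (p * a) ^ p⁻¹ ∧ ((p * a) ^ p⁻¹) ^ p / p = a := by
    intro a ha
    refine ⟨by positivity, ?_⟩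
    rw [Real.rpow_inv_rpow (by positivity) hp0.ne']
    field_simp
  by_cases h2 : 2 ≤ p
  · obtain ⟨h3, h4⟩ := hroot h h.2
    exact ⟨⟨_, h3⟩, by simp only [phi, if_pos h2]; exact h4⟩
  by_cases h3 : (h : ℝ) ≤ 1 / 2
  · have hs := Real.sq_sqrt (show (0 : ℝ) ≤ 2 * h by positivity)
    refine ⟨⟨Real.sqrt (2 * h), Real.sqrt_nonneg _⟩, ?_⟩
    have : Real.sqrt (2 * h) ≤ 1 := Real.sqrt_le_one.2 (by linarith)
    change phi p (Real.sqrt (2 * h)) = h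
    rw [phi, if_neg h2, if_pos this]
    linarith
  · have hinv : 0 < 1 / p := by positivity
    obtain ⟨h4, h5⟩ := hroot (h - 1 / 2 + 1 / p) (by linarith)
    refine ⟨⟨_, h4⟩, ?_⟩
    have : ¬ (p * ((h : ℝ) - 1 / 2 + 1 / p)) ^ p⁻¹ ≤ 1 := by
      rw [not_le]
      refine Real.one_lt_rpow ?_ (by positivity)
      have : p * (1 / p) = 1 := by field_simp
      nlinarith
    change phi p ((p * ((h : ℝ) - 1 / 2 + 1 / p)) ^ p⁻¹) = h
    rw [phi, if_neg h2, if_neg this]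
    linarith

theorem phiInv_top (p : ℝ) : phiInv p ∞ = ∞ := by
  refine ENNReal.eq_top_of_forall_nnreal_le fun x => ?_
  exact le_iSup₂_of_le x le_top le_rfl

/-- `μ` satisfies the `p`-exponential concentration inequality with constant `D`:
`K(r) ≥ (D r) ^ p - 1` for all `r ≥ 0`. -/
def ExpConcentration {Ω : Type*} [MetricSpace Ω] [MeasurableSpace Ω]
    (μ : Measure Ω) (p : ℝ) (D : ℝ≥0) : Prop :=
  ∀ r : ℝ, 0 ≤ r → ((((D : ℝ) * r) ^ p - 1 : ℝ) : EReal) ≤ logConcentrationProfile μ r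

/-- `μ` satisfies the weak `(1, p)` Transport-Entropy inequality with constant `D`:
`D W₁(ν, μ) ≤ H(ν | μ) ^ (1 / p) + 1` for all probability measures `ν`. -/
def WeakTransportEntropy {Ω : Type*} [MetricSpace Ω] [MeasurableSpace Ω]
    (μ : Measure Ω) (p : ℝ) (D : ℝ≥0) : Prop :=
  ∀ ν : Measure Ω, IsProbabilityMeasure ν →
    (D : ℝ≥0∞) * wasserstein₁ ν μ ≤ InformationTheory.klDiv ν μ ^ (1 / p) + 1

/-- `μ` satisfies the (tight) `(1, φ_p)` Transport-Entropy inequality with constant `D`: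
`D W₁(ν, μ) ≤ φ_p⁻¹(H(ν | μ))` for all probability measures `ν`. -/
def TightTransportEntropy {Ω : Type*} [MetricSpace Ω] [MeasurableSpace Ω]
    (μ : Measure Ω) (p : ℝ) (D : ℝ≥0) : Prop :=
  ∀ ν : Measure Ω, IsProbabilityMeasure ν →
    (D : ℝ≥0∞) * wasserstein₁ ν μ ≤ phiInv p (InformationTheory.klDiv ν μ)

/-- The best constant in an inequality: the supremum in `[0, ∞]` of the constants `D ≥ 0` with
which it holds. -/
def bestConstant (P : ℝ≥0 → Prop) : ℝ≥0∞ :=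
  ⨆ (D : ℝ≥0) (_ : P D), (D : ℝ≥0∞)

end

end TransportConcentration

namespace TransportConcentration

/-! The cycle concentration ⟹ tight ⟹ weak ⟹ concentration is closed with losses `100`, `2` and `4`
in the constant.

Concentration ⟹ tight. By Kantorovich–Rubinstein duality it suffices to bound `∫ f dν - ∫ f dμ` for
`1`-Lipschitz `f`. Concentration about a median `m` makes `exp(|X|^p / 2)` integrable under `μ`,
with a universal bound, for `X = D (f - m)`. The entropy inequality `∫ X dν ≤ H + ∫ (e^X - 1) dμ`
carries this over to `ν`. For `H ≥ 1`, applied to `|X|^p / 2`, it bounds the difference of means of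
`X` by a multiple of `H^(1/p)`. For `H ≤ 1`, applied to a small multiple `t X`, the mean of `X`
under `μ` cancels, the rest is `H + O(t²)`, and `t = √H` gives a multiple of `√H`. Both are
dominated by `φ_p⁻¹(H)` (`rpow_le_of_one_le_phi`, `sqrt_phi_le`).

Tight ⟹ weak is the comparison `φ_p⁻¹(h) ≤ 2 (h^(1/p) + 1)`.

Weak ⟹ concentration is Marton's argument: condition `μ` on `A` and on `B = (A_r)ᶜ`. The distance to
`A` shows that the two conditioned measures have `W₁`-distances to `μ` adding up to at least `r`,
while their entropies are at most `log 2` and `-log μ(B)`. -/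

/-! ### Transport duality on finite sets -/

/-- **Finite transport duality.** Either there is a coupling of `a` and `b` of cost at most `V`, or
there is a dual certificate that the cost exceeds `V`. -/
theorem exists_coupling_or_exists_dual {ι κ : Type*} [Fintype ι] [Fintype κ] {a : ι → ℝ}
    {b : κ → ℝ} (ha : a ∈ stdSimplex ℝ ι) (hb : b ∈ stdSimplex ℝ κ) (c : ι → κ → ℝ) (V : ℝ) :
    (∃ q : ι × κ → ℝ, (∀ z, 0 ≤ q z) ∧ (∀ i, ∑ j, q (i, j) = a i) ∧ (∀ j, ∑ i, q (i, j) = b j) ∧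
      ∑ z, q z * c z.1 z.2 ≤ V) ∨
    ∃ (F : ι → ℝ) (G : κ → ℝ), (∀ i j, F i + G j ≤ c i j) ∧
      V < ∑ i, a i * F i + ∑ j, b j * G j := by
  classical
  -- `L` records the two marginals and the cost of a plan. A coupling of cost at most `V` is a point
  -- where the image of the simplex meets `{a} × {b} × (-∞, V]`; otherwise Hahn–Banach separates the
  -- two sets.
  let L : (ι × κ → ℝ) →ₗ[ℝ] (ι → ℝ) × (κ → ℝ) × ℝ :=
    { toFun := fun q => (fun i => ∑ j, q (i, j), fun j => ∑ i, q (i, j), ∑ z, q z * c z.1 z.2)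
      map_add' := fun q r => by
        simp only [Pi.add_apply, Finset.sum_add_distrib, add_mul]; rfl
      map_smul' := fun s q => by
        simp only [Pi.smul_apply, smul_eq_mul, RingHom.id_apply, mul_assoc, ← Finset.mul_sum]; rfl }
  by_cases hdisj : Disjoint (L '' stdSimplex ℝ (ι × κ)) ({a} ×ˢ {b} ×ˢ Set.Iic V)
  swap
  · obtain ⟨_, ⟨q, hq, rfl⟩, hqt⟩ := Set.not_disjoint_iff.1 hdisj
    simp only [Set.mem_prod, Set.mem_singleton_iff, Set.mem_Iic] at hqt
    exact Or.inl ⟨q, hq.1, fun i => congrFun hqt.1 i, fun j => congrFun hqt.2.1 j, hqt.2.2⟩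
  right
  have hLc : Continuous L := L.continuous_of_finiteDimensional
  obtain ⟨φ, u, v, hs, huv, ht⟩ := geometric_hahn_banach_compact_closed
    ((convex_stdSimplex ℝ (ι × κ)).linear_image L) ((isCompact_stdSimplex ℝ (ι × κ)).image hLc)
    ((convex_singleton a).prod ((convex_singleton b).prod (convex_Iic V)))
    (isClosed_singleton.prod (isClosed_singleton.prod isClosed_Iic)) hdisj
  set f : ι → ℝ := fun i => φ (Pi.single i 1, 0, 0) with hf
  set g : κ → ℝ := fun j => φ (0, Pi.single j 1, 0) with hg
  set h : ℝ := φ (0, 0, 1) with hh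
  have hι : ∀ i : ι, (fun j => if i = j then (1 : ℝ) else 0) = Pi.single i 1 := fun i => by
    ext j; simp [Pi.single_apply, eq_comm]
  have hκ : ∀ i : κ, (fun j => if i = j then (1 : ℝ) else 0) = Pi.single i 1 := fun i => by
    ext j; simp [Pi.single_apply, eq_comm]
  have hφ : ∀ x y t, φ (x, y, t) = ∑ i, x i * f i + ∑ j, y j * g j + t * h := by
    intro x y t
    have e1 : φ (x, 0, 0) = ∑ i, x i * f i := by
      have := LinearMap.pi_apply_eq_sum_univ
        (φ.toLinearMap ∘ₗ LinearMap.inl ℝ (ι → ℝ) ((κ → ℝ) × ℝ)) x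
      simpa [hf, Prod.zero_eq_mk, hι] using this
    have e2 : φ (0, y, 0) = ∑ j, y j * g j := by
      have := LinearMap.pi_apply_eq_sum_univ
        (φ.toLinearMap ∘ₗ LinearMap.inr ℝ (ι → ℝ) ((κ → ℝ) × ℝ) ∘ₗ LinearMap.inl ℝ (κ → ℝ) ℝ) y
      simpa [hg, hκ] using this
    have e3 : φ (0, 0, t) = t * h := by
      rw [hh, ← smul_eq_mul, ← map_smul]; simp
    rw [← e1, ← e2, ← e3, ← map_add, ← map_add]; simp
  have h1 : ∀ i j, f i + g j + c i j * h < u := by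
    intro i j
    have := hs _ ⟨Pi.single (i, j) 1, single_mem_stdSimplex ℝ (i, j), rfl⟩
    have e : L (Pi.single (i, j) 1) = (Pi.single i 1, Pi.single j 1, c i j) := by
      refine Prod.ext (funext fun i' => ?_) (Prod.ext (funext fun j' => ?_) ?_)
      · simp [L, Pi.single_apply, Prod.ext_iff, ite_and]
      · simp [L, Pi.single_apply, Prod.ext_iff, ite_and]
      · simp [L, Pi.single_apply]
    rw [e, hφ] at this
    simpa [Pi.single_apply] using this
  set S := ∑ i, a i * f i + ∑ j, b j * g j with hS
  have h2 : ∀ t ≤ V, v < S + t * h := by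
    intro t htV
    rw [← hφ]
    exact ht _ ⟨rfl, rfl, htV⟩
  have hdouble : ∀ (x : ι → ℝ) (y : κ → ℝ), ∑ i, a i * x i + ∑ j, b j * y j =
      ∑ i, ∑ j, a i * b j * (x i + y j) := by
    intro x y
    have : ∀ i, ∑ j, a i * b j * (x i + y j) = a i * x i + a i * ∑ j, b j * y j := by
      intro i
      have e : a i * x i = ∑ j, b j * (a i * x i) := by rw [← Finset.sum_mul, hb.2, one_mul]
      rw [e, Finset.mul_sum, ← Finset.sum_add_distrib]
      exact Finset.sum_congr rfl fun j _ => by ring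
    simp_rw [this, Finset.sum_add_distrib, ← Finset.sum_mul, ha.2, one_mul]
  -- If `h = 0`, averaging `h1` against `a ⊗ b` gives `S ≤ u`, against `u < v < S`. If `h > 0`,
  -- letting `t → -∞` violates `h2`.
  have hneg : h < 0 := by
    by_contra hcon
    rcases (not_lt.1 hcon).eq_or_lt with h0 | hpos
    · have e : S ≤ u := by
        have hu : u = ∑ i, a i * u + ∑ j, b j * (0 : ℝ) := by
          simp [← Finset.sum_mul, ha.2]
        rw [hu, hS, hdouble, hdouble]
        refine Finset.sum_le_sum fun i _ => Finset.sum_le_sum fun j _ =>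
          mul_le_mul_of_nonneg_left ?_ (mul_nonneg (ha.1 i) (hb.1 j))
        have := h1 i j
        rw [← h0] at this
        linarith
      have := h2 V le_rfl
      rw [← h0] at this
      linarith
    · have := h2 (min V ((v - S) / h)) (min_le_left _ _)
      have h3 : min V ((v - S) / h) * h ≤ (v - S) / h * h := by gcongr; exact min_le_right _ _
      rw [div_mul_cancel₀ _ hpos.ne'] at h3
      linarith
  refine ⟨fun i => (f i - u) / (-h), fun j => g j / (-h), fun i j => ?_, ?_⟩
  · rw [← add_div, div_le_iff₀ (by linarith)]
    linarith [h1 i j]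
  · have e : ∑ i, a i * ((f i - u) / (-h)) + ∑ j, b j * (g j / (-h)) = (S - u) / (-h) := by
      have : ∑ i, a i * u = u := by rw [← Finset.sum_mul, ha.2, one_mul]
      simp_rw [← mul_div_assoc, ← Finset.sum_div, mul_sub, Finset.sum_sub_distrib, this]
      rw [hS]; ring
    rw [e, lt_div_iff₀ (by linarith)]
    linarith [h2 V le_rfl]

/-! ### Lifting a coupling of discretisations -/

section Lift

variable {Ω : Type*} [MeasurableSpace Ω]

theorem lintegral_comp_simpleFunc (ν : Measure Ω) {β : Type*} (T : SimpleFunc Ω β)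
    (g : β → ℝ≥0∞) : ∫⁻ x, g (T x) ∂ν = ∑ i ∈ T.range, g i * ν (T ⁻¹' {i}) := by
  rw [← SimpleFunc.map_lintegral, ← SimpleFunc.lintegral_eq_lintegral]
  rfl

theorem measurable_comp_simpleFunc_prod {β : Type*} (T : SimpleFunc Ω β) (w : β → β → ℝ≥0∞) :
    Measurable fun z : Ω × Ω => w (T z.1) (T z.2) :=
  (((T.comp Prod.fst measurable_fst).pair (T.comp Prod.snd measurable_snd)).map
    (Function.uncurry w)).measurable

theorem ae_measure_preimage_ne_zero (ν : Measure Ω) {β : Type*} (T : SimpleFunc Ω β) :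
    ∀ᵐ x ∂ν, ν (T ⁻¹' {T x}) ≠ 0 := by
  have : ∀ i ∈ T.range, ∀ᵐ x ∂ν, T x = i → ν (T ⁻¹' {i}) ≠ 0 := by
    intro i _
    by_cases h0 : ν (T ⁻¹' {i}) = 0
    · filter_upwards [measure_eq_zero_iff_ae_notMem.1 h0] with x hx hxi
      exact absurd hxi hx
    · exact Filter.Eventually.of_forall fun _ _ => h0
  filter_upwards [(Finset.eventually_all T.range).2 this] with x hx
  exact hx _ (T.mem_range_self x) rfl

/-- A density depending only on a discretisation has prescribed first marginal as soon as its
discretisation does. -/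
theorem lintegral_prod_simpleFunc_density (ν μ : Measure Ω) [SFinite μ] {β : Type*}
    (T : SimpleFunc Ω β) (w : β → β → ℝ≥0∞)
    (hw : ∀ i ∈ T.range, ν (T ⁻¹' {i}) ≠ 0 → ∑ j ∈ T.range, w i j * μ (T ⁻¹' {j}) = 1)
    {h : Ω → ℝ≥0∞} (hh : Measurable h) :
    ∫⁻ z, w (T z.1) (T z.2) * h z.1 ∂(ν.prod μ) = ∫⁻ x, h x ∂ν := by
  have hm := measurable_comp_simpleFunc_prod T w
  have hhm : Measurable fun z : Ω × Ω => w (T z.1) (T z.2) * h z.1 := hm.mul (hh.comp measurable_fst)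
  rw [lintegral_prod _ hhm.aemeasurable]
  refine lintegral_congr_ae ?_
  filter_upwards [ae_measure_preimage_ne_zero ν T] with x hx
  have hmx : Measurable fun y => w (T x) (T y) := (T.map (w (T x))).measurable
  rw [lintegral_mul_const _ hmx, lintegral_comp_simpleFunc μ T (w (T x)),
    hw _ (T.mem_range_self x) hx, one_mul]

/-- The density `q i j / (ν {T = i} μ {T = j})` that lifts a coupling `q` of the discretisations of
`ν` and `μ` has unit conditional mass. -/
theorem sum_div_mul_measure_preimage (ν μ : Measure Ω) [IsFiniteMeasure ν] [IsFiniteMeasure μ]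
    {β : Type*} (T : SimpleFunc Ω β) (q : β → β → ℝ≥0∞)
    (hrow : ∀ i ∈ T.range, ∑ j ∈ T.range, q i j = ν (T ⁻¹' {i}))
    (hcol : ∀ j ∈ T.range, ∑ i ∈ T.range, q i j = μ (T ⁻¹' {j}))
    {i : β} (hi : i ∈ T.range) (hi0 : ν (T ⁻¹' {i}) ≠ 0) :
    ∑ j ∈ T.range, q i j / (ν (T ⁻¹' {i}) * μ (T ⁻¹' {j})) * μ (T ⁻¹' {j}) = 1 := by
  have : ∀ j ∈ T.range, q i j / (ν (T ⁻¹' {i}) * μ (T ⁻¹' {j})) * μ (T ⁻¹' {j}) =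
      q i j * (ν (T ⁻¹' {i}))⁻¹ := by
    intro j hj
    by_cases h0 : μ (T ⁻¹' {j}) = 0
    -- A null column forces `q i j = 0`, so the division by zero is harmless.
    · have := hcol j hj
      rw [h0, Finset.sum_eq_zero_iff] at this
      simp [this i hi]
    · rw [← div_eq_mul_inv, ← ENNReal.mul_div_mul_right (q i j) (ν _) h0 (measure_ne_top _ _)]
      simp only [div_eq_mul_inv]
      ring
  rw [Finset.sum_congr rfl this, ← Finset.sum_mul, hrow i hi,
    ENNReal.mul_inv_cancel hi0 (measure_ne_top _ _)]

/-- A coupling of the discretisations of `ν` and `μ` along a simple function `T` lifts to a coupling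
of `ν` and `μ`. -/
theorem transportCost_edist_le_of_simpleFunc [PseudoEMetricSpace Ω] [BorelSpace Ω]
    [SecondCountableTopology Ω]
    (ν μ : Measure Ω) [IsProbabilityMeasure ν] [IsProbabilityMeasure μ] (T : SimpleFunc Ω Ω)
    (q : Ω → Ω → ℝ≥0∞) (hrow : ∀ i ∈ T.range, ∑ j ∈ T.range, q i j = ν (T ⁻¹' {i}))
    (hcol : ∀ j ∈ T.range, ∑ i ∈ T.range, q i j = μ (T ⁻¹' {j})) :
    transportCost (fun x y => edist x y) ν μ ≤
      ∑ i ∈ T.range, ∑ j ∈ T.range, q i j * edist i j +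
        (∫⁻ x, edist x (T x) ∂ν + ∫⁻ x, edist x (T x) ∂μ) := by
  set w : Ω → Ω → ℝ≥0∞ := fun i j => q i j / (ν (T ⁻¹' {i}) * μ (T ⁻¹' {j})) with hw
  have hwm := measurable_comp_simpleFunc_prod T w
  set P := (ν.prod μ).withDensity fun z => w (T z.1) (T z.2) with hP
  have hint : ∀ h : Ω × Ω → ℝ≥0∞, Measurable h →
      ∫⁻ z, h z ∂P = ∫⁻ z, w (T z.1) (T z.2) * h z ∂(ν.prod μ) := fun h hh => by
    rw [hP, lintegral_withDensity_eq_lintegral_mul _ hwm hh]; rfl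
  have hfst : ∀ h : Ω → ℝ≥0∞, Measurable h → ∫⁻ z, h z.1 ∂P = ∫⁻ x, h x ∂ν := fun h hh => by
    rw [hint (fun z => h z.1) (hh.comp measurable_fst)]
    exact lintegral_prod_simpleFunc_density ν μ T w
      (fun i hi hi0 => sum_div_mul_measure_preimage ν μ T q hrow hcol hi hi0) hh
  have hsnd : ∀ h : Ω → ℝ≥0∞, Measurable h → ∫⁻ z, h z.2 ∂P = ∫⁻ x, h x ∂μ := fun h hh => by
    -- Swapping the factors reduces the second marginal to the first.
    rw [hint (fun z => h z.2) (hh.comp measurable_snd), ← lintegral_prod_swap]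
    refine lintegral_prod_simpleFunc_density μ ν T (fun i j => w j i) (fun i hi hi0 => ?_) hh
    rw [← sum_div_mul_measure_preimage μ ν T (fun i j => q j i) hcol hrow hi hi0]
    simp only [hw, mul_comm (μ _)]
  have hPfst : P.fst = ν := by
    refine Measure.ext_of_lintegral _ fun h hh => ?_
    rw [Measure.fst, lintegral_map hh measurable_fst, hfst h hh]
  have hPsnd : P.snd = μ := by
    refine Measure.ext_of_lintegral _ fun h hh => ?_
    rw [Measure.snd, lintegral_map hh measurable_snd, hsnd h hh]
  have hprob : IsProbabilityMeasure P := ⟨by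
    rw [← Measure.fst_univ, hPfst, measure_univ]⟩
  have hTm : Measurable fun x => edist x (T x) := measurable_id.edist T.measurable
  have hT2 : Measurable fun z : Ω × Ω => edist (T z.1) (T z.2) :=
    measurable_comp_simpleFunc_prod T fun i j => edist i j
  have hmid : ∫⁻ z, edist (T z.1) (T z.2) ∂P ≤ ∑ i ∈ T.range, ∑ j ∈ T.range, q i j * edist i j := by
    have hm : Measurable fun z : Ω × Ω => w (T z.1) (T z.2) * edist (T z.1) (T z.2) :=
      hwm.mul hT2
    rw [hint _ hT2, lintegral_prod _ hm.aemeasurable]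
    have h1 : ∀ x, ∫⁻ y, w (T x) (T y) * edist (T x) (T y) ∂μ =
        ∑ j ∈ T.range, w (T x) j * edist (T x) j * μ (T ⁻¹' {j}) := fun x =>
      lintegral_comp_simpleFunc μ T fun j => w (T x) j * edist (T x) j
    simp only [h1]
    rw [lintegral_comp_simpleFunc ν T
      fun i => ∑ j ∈ T.range, w i j * edist i j * μ (T ⁻¹' {j})]
    refine Finset.sum_le_sum fun i _ => ?_
    rw [Finset.sum_mul]
    refine Finset.sum_le_sum fun j _ => ?_
    calc w i j * edist i j * μ (T ⁻¹' {j}) * ν (T ⁻¹' {i})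
        = w i j * (ν (T ⁻¹' {i}) * μ (T ⁻¹' {j})) * edist i j := by ring
      _ ≤ q i j * edist i j := by gcongr; exact ENNReal.mul_le_of_le_div le_rfl
  calc transportCost (fun x y => edist x y) ν μ
      ≤ ∫⁻ z, edist z.1 z.2 ∂P := iInf₂_le P ⟨hprob, hPfst, hPsnd⟩
    _ ≤ ∫⁻ z, edist (T z.1) (T z.2) + (edist z.1 (T z.1) + edist z.2 (T z.2)) ∂P := by
        refine lintegral_mono fun z => ?_
        calc edist z.1 z.2 ≤ edist z.1 (T z.1) + edist (T z.1) (T z.2) + edist (T z.2) z.2 :=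
              edist_triangle4 _ _ _ _
          _ = _ := by rw [edist_comm (T z.2) z.2]; ring
    _ = ∫⁻ z, edist (T z.1) (T z.2) ∂P +
          (∫⁻ x, edist x (T x) ∂ν + ∫⁻ x, edist x (T x) ∂μ) := by
        have hT1 : Measurable fun z : Ω × Ω => edist z.1 (T z.1) := hTm.comp measurable_fst
        rw [lintegral_add_left hT2, lintegral_add_left hT1, hfst _ hTm, hsnd _ hTm]
    _ ≤ _ := by gcongr

end Lift

/-! ### Kantorovich–Rubinstein duality -/

section Duality

/-- The infimum of finitely many translated distance functions is `1`-Lipschitz. -/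
theorem lipschitzWith_inf'_dist_sub {Ω ι : Type*} [PseudoMetricSpace Ω] {s : Finset ι} (hs : s.Nonempty) (y : ι → Ω)
    (G : ι → ℝ) : LipschitzWith 1 fun x => s.inf' hs fun j => dist x (y j) - G j := by
  refine LipschitzWith.of_le_add fun x x' => ?_
  rw [← sub_le_iff_le_add, Finset.le_inf'_iff]
  intro j hj
  have := Finset.inf'_le (fun j => dist x (y j) - G j) hj
  linarith [dist_triangle x x' (y j)]

variable {Ω : Type*} [MeasurableSpace Ω]

theorem integral_comp_simpleFunc (ν : Measure Ω) [IsFiniteMeasure ν] {β : Type*}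
    (T : SimpleFunc Ω β) (φ : β → ℝ) :
    ∫ x, φ (T x) ∂ν = ∑ i : T.range, ν.real (T ⁻¹' {(i : β)}) * φ i := by
  classical
  have h1 : ∀ x, φ (T x) = ∑ i : T.range, (T ⁻¹' {(i : β)}).indicator (fun _ => φ i) x := by
    intro x
    rw [Finset.sum_eq_single_of_mem ⟨T x, T.mem_range_self x⟩ (Finset.mem_univ _)]
    · simp
    · intro i _ hi
      refine Set.indicator_of_notMem (fun h => hi (Subtype.ext ?_)) _
      exact (Set.mem_singleton_iff.1 h).symm
  simp_rw [h1]
  rw [integral_finsetSum]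
  · refine Finset.sum_congr rfl fun i _ => ?_
    rw [integral_indicator_const _ (T.measurableSet_fiber i), smul_eq_mul]
  · exact fun i _ => (integrable_const _).indicator (T.measurableSet_fiber i)

variable [PseudoMetricSpace Ω] [BorelSpace Ω]

theorem integrable_of_lipschitzWith {ν : Measure Ω} [IsFiniteMeasure ν] {x₀ : Ω}
    (hν : Integrable (fun x => dist x x₀) ν) {f : Ω → ℝ} (hf : LipschitzWith 1 f) :
    Integrable f ν := by
  refine ((integrable_const |f x₀|).add hν).mono' hf.continuous.measurable.aestronglyMeasurable
    (Filter.Eventually.of_forall fun x => ?_)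
  have := hf.dist_le_mul x x₀
  simp only [NNReal.coe_one, one_mul, Real.dist_eq] at this
  have h2 := abs_add_le (f x - f x₀) (f x₀)
  simp only [sub_add_cancel] at h2
  simp only [Real.norm_eq_abs, Pi.add_apply]
  linarith

theorem integral_comp_simpleFunc_le {ν : Measure Ω} [IsFiniteMeasure ν] {x₀ : Ω}
    (hν : Integrable (fun x => dist x x₀) ν) {f : Ω → ℝ} (hf : LipschitzWith 1 f)
    {T : SimpleFunc Ω Ω} {δ : ℝ≥0} (hT : ∫⁻ x, edist x (T x) ∂ν ≤ δ) :
    ∫ x, f (T x) ∂ν ≤ ∫ x, f x ∂ν + δ := by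
  have hi := integrable_of_lipschitzWith hν hf
  have hiT : Integrable (fun x => f (T x)) ν := (T.map f).integrable_of_isFiniteMeasure
  have hle : ∀ x, ‖f (T x) - f x‖ₑ ≤ edist x (T x) := fun x => by
    rw [← edist_eq_enorm_sub, edist_comm]
    simpa using hf x (T x)
  have h1 : ∫ x, f (T x) - f x ∂ν ≤ δ := by
    refine (Real.le_norm_self _).trans ?_
    have := (enorm_integral_le_lintegral_enorm (μ := ν) fun x => f (T x) - f x).trans
      ((lintegral_mono hle).trans hT)
    exact_mod_cast enorm_le_coe.1 this
  rw [integral_sub hiT hi] at h1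
  linarith

theorem exists_simpleFunc_lintegral_edist_le [TopologicalSpace.SeparableSpace Ω]
    (ν μ : Measure Ω) {x₀ : Ω}
    [IsFiniteMeasure ν] [IsFiniteMeasure μ]
    (hν : Integrable (fun x => dist x x₀) ν) (hμ : Integrable (fun x => dist x x₀) μ)
    {δ : ℝ≥0} (hδ : 0 < δ) :
    ∃ T : SimpleFunc Ω Ω, ∫⁻ x, edist x (T x) ∂ν ≤ δ ∧ ∫⁻ x, edist x (T x) ∂μ ≤ δ := by
  have : Nonempty Ω := ⟨x₀⟩
  set u := TopologicalSpace.denseSeq Ω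
  have key : ∀ ρ : Measure Ω, IsFiniteMeasure ρ → Integrable (fun x => dist x x₀) ρ →
      Filter.Tendsto (fun N => ∫⁻ x, edist x (SimpleFunc.nearestPt u N x) ∂ρ) Filter.atTop
        (nhds 0) := by
    intro ρ _ hρ
    have hi : Integrable (fun x => dist (u 0) x) ρ :=
      integrable_of_lipschitzWith hρ (LipschitzWith.dist_right _)
    have h0 : (0 : ℝ≥0∞) = ∫⁻ x : Ω, 0 ∂ρ := by simp
    rw [h0]
    -- The nearest of the first points of the dense sequence is never farther than `u 0`, whose
    -- distance is an integrable majorant.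
    refine tendsto_lintegral_of_dominated_convergence (fun x => edist (u 0) x)
      (fun N => measurable_id.edist (SimpleFunc.measurable _))
      (fun N => Filter.Eventually.of_forall fun x => ?_) ?_
      (Filter.Eventually.of_forall fun x => ?_)
    · simpa only [edist_comm] using SimpleFunc.edist_nearestPt_le u x (Nat.zero_le N)
    · have := hi.2
      rw [hasFiniteIntegral_iff_enorm] at this
      simpa [edist_dist, Real.enorm_eq_ofReal dist_nonneg] using this.ne
    · have := (SimpleFunc.tendsto_nearestPt (e := u)
        (TopologicalSpace.denseRange_denseSeq Ω x))
      simpa using (tendsto_const_nhds (x := x)).edist this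
  have hδ' : (0 : ℝ≥0∞) < δ := by exact_mod_cast hδ
  obtain ⟨N, h1, h2⟩ := (((key ν inferInstance hν).eventually_lt_const hδ').and
    ((key μ inferInstance hμ).eventually_lt_const hδ')).exists
  exact ⟨_, h1.le, h2.le⟩

/-- **Kantorovich–Rubinstein duality**, the direction that bounds the transport cost. -/
theorem transportCost_edist_le_of_lipschitz [TopologicalSpace.SeparableSpace Ω]
    {ν μ : Measure Ω} [IsProbabilityMeasure ν] [IsProbabilityMeasure μ] {x₀ : Ω}
    (hν : Integrable (fun x => dist x x₀) ν) (hμ : Integrable (fun x => dist x x₀) μ) {V : ℝ}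
    (hV : ∀ f : Ω → ℝ, LipschitzWith 1 f → ∫ x, f x ∂ν - ∫ x, f x ∂μ ≤ V) :
    transportCost (fun x y => edist x y) ν μ ≤ ENNReal.ofReal V := by
  classical
  have := UniformSpace.secondCountable_of_separable Ω
  have hV0 : 0 ≤ V := by simpa using hV (fun _ => 0) (LipschitzWith.const' 0)
  refine ENNReal.le_of_forall_pos_le_add fun ε hε _ => ?_
  obtain ⟨T, hTν, hTμ⟩ := exists_simpleFunc_lintegral_edist_le ν μ hν hμ
    (δ := ε / 4) (by positivity)
  have hsimplex : ∀ ρ : Measure Ω, IsProbabilityMeasure ρ →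
      (fun i : T.range => ρ.real (T ⁻¹' {(i : Ω)})) ∈ stdSimplex ℝ T.range := by
    intro ρ _
    refine ⟨fun _ => measureReal_nonneg, ?_⟩
    have := integral_comp_simpleFunc ρ T fun _ => (1 : ℝ)
    simpa using this.symm
  -- The two discretisation errors add up to `ε / 2`. With a coupling they complete the slack to
  -- `ε`; with a dual pair they are exactly absorbed by the slack `ε / 2`.
  rcases exists_coupling_or_exists_dual (hsimplex ν inferInstance) (hsimplex μ inferInstance)
    (fun i j => dist (i : Ω) j) (V + ε / 2) with ⟨q, hq0, hrow, hcol, hcost⟩ | ⟨F, G, hFG, hlt⟩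
  · set Q : Ω → Ω → ℝ≥0∞ := fun i j =>
      if h : i ∈ T.range ∧ j ∈ T.range then ENNReal.ofReal (q (⟨i, h.1⟩, ⟨j, h.2⟩)) else 0 with hQ
    have hQq : ∀ i j : T.range, Q i j = ENNReal.ofReal (q (i, j)) := fun i j => by
      rw [hQ]; exact dif_pos ⟨i.2, j.2⟩
    refine (transportCost_edist_le_of_simpleFunc ν μ T Q (fun i hi => ?_) fun j hj => ?_).trans ?_
    · rw [← Finset.sum_coe_sort]
      simp_rw [hQq ⟨i, hi⟩]
      rw [← ENNReal.ofReal_sum_of_nonneg fun _ _ => hq0 _, hrow, ofReal_measureReal]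
    · rw [← Finset.sum_coe_sort]
      simp_rw [hQq _ ⟨j, hj⟩]
      rw [← ENNReal.ofReal_sum_of_nonneg fun _ _ => hq0 _, hcol, ofReal_measureReal]
    · have e : ∑ i ∈ T.range, ∑ j ∈ T.range, Q i j * edist i j =
          ENNReal.ofReal (∑ z, q z * dist (z.1 : Ω) z.2) := by
        rw [Fintype.sum_prod_type, ENNReal.ofReal_sum_of_nonneg fun _ _ =>
          Finset.sum_nonneg fun _ _ => mul_nonneg (hq0 _) dist_nonneg, ← Finset.sum_coe_sort]
        refine Finset.sum_congr rfl fun i _ => ?_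
        rw [ENNReal.ofReal_sum_of_nonneg fun _ _ => mul_nonneg (hq0 _) dist_nonneg,
          ← Finset.sum_coe_sort]
        refine Finset.sum_congr rfl fun j _ => ?_
        rw [hQq, edist_dist, ENNReal.ofReal_mul (hq0 _)]
      rw [e]
      calc _ ≤ ENNReal.ofReal (V + ε / 2) + (((ε / 4 : ℝ≥0) : ℝ≥0∞) + (ε / 4 : ℝ≥0)) := by gcongr
        _ = ENNReal.ofReal V + ε := by
          rw [ENNReal.ofReal_add hV0 (by positivity), add_assoc, ← ENNReal.coe_add]
          congr 1
          have : (ε / 2 : ℝ) = ((ε / 2 : ℝ≥0) : ℝ) := by simp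
          rw [this, ENNReal.ofReal_coe_nnreal, ← ENNReal.coe_add]
          congr 1
          ext; push_cast; ring
  · exfalso
    have hne : (Finset.univ : Finset T.range).Nonempty :=
      ⟨⟨T x₀, T.mem_range_self x₀⟩, Finset.mem_univ _⟩
    -- The `c`-transform of `G` replaces the pair `(F, G)` by `(φ, -φ)` with `φ` `1`-Lipschitz on
    -- all of `Ω`, without lowering the dual value.
    set φ : Ω → ℝ := fun x => Finset.univ.inf' hne fun j : T.range => dist x (j : Ω) - G j with hφ
    have hL : LipschitzWith 1 φ := lipschitzWith_inf'_dist_sub hne (fun j : T.range => (j : Ω)) G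
    have hF : ∀ i, F i ≤ φ i := fun i => (Finset.le_inf'_iff _ _).2 fun j _ => by
      linarith [hFG i j]
    have hG : ∀ j, G j ≤ -φ j := fun j => by
      have := Finset.inf'_le (fun k : T.range => dist (j : Ω) (k : Ω) - G k) (Finset.mem_univ j)
      rw [dist_self] at this
      linarith
    have h1 : ∑ i : T.range, ν.real (T ⁻¹' {(i : Ω)}) * F i ≤ ∫ x, φ (T x) ∂ν := by
      rw [integral_comp_simpleFunc]
      gcongr with i _
      exact hF i
    have h2 : ∑ j : T.range, μ.real (T ⁻¹' {(j : Ω)}) * G j ≤ ∫ x, -φ (T x) ∂μ := by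
      rw [integral_comp_simpleFunc μ T fun x => -φ x]
      gcongr with j _
      exact hG j
    have h3 := integral_comp_simpleFunc_le hν hL hTν
    have h4 := integral_comp_simpleFunc_le hμ hL.neg hTμ
    have h5 := hV φ hL
    simp only [integral_neg] at h2
    simp only [Pi.neg_apply, integral_neg] at h4
    push_cast at h3 h4
    linarith

end Duality

/-! ### Medians and concentration of Lipschitz functions -/

section Concentration

/-- Take the infimum of the levels where the distribution function is at least `1/2`: right
continuity gives one inequality, the left limit the other. -/
theorem exists_median {Ω : Type*} [MeasurableSpace Ω] (μ : Measure Ω) [IsProbabilityMeasure μ]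
    {f : Ω → ℝ} (hf : Measurable f) :
    ∃ m, 1 / 2 ≤ μ {x | f x ≤ m} ∧ 1 / 2 ≤ μ {x | m ≤ f x} := by
  have hprob : IsProbabilityMeasure (μ.map f) := Measure.isProbabilityMeasure_map hf.aemeasurable
  set ν := μ.map f with hν
  set F := ProbabilityTheory.cdf ν with hF
  have hbot := ProbabilityTheory.tendsto_cdf_atBot ν
  have htop := ProbabilityTheory.tendsto_cdf_atTop ν
  set S := {t : ℝ | 1 / 2 ≤ F t} with hS
  have hne : S.Nonempty := by
    obtain ⟨t, ht⟩ := (htop.eventually_const_le (by norm_num : (1 / 2 : ℝ) < 1)).exists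
    exact ⟨t, ht⟩
  have hbdd : BddBelow S := by
    obtain ⟨t, ht⟩ := (hbot.eventually_lt_const (by norm_num : (0 : ℝ) < 1 / 2)).exists
    refine ⟨t, fun s hs => le_of_not_gt fun hst => ?_⟩
    exact absurd (hs.trans (F.mono hst.le)) (not_le.2 ht)
  have hgt : ∀ t, sInf S < t → 1 / 2 ≤ F t := fun t ht => by
    obtain ⟨s, hs, hst⟩ := exists_lt_of_csInf_lt hne ht
    exact le_trans hs (F.mono hst.le)
  have hlt : ∀ t, t < sInf S → F t < 1 / 2 := fun t ht => not_le.1 fun h =>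
    absurd (csInf_le hbdd h) (not_le.2 ht)
  have hhalf : ENNReal.ofReal (1 / 2) = 1 / 2 := by
    rw [ENNReal.ofReal_div_of_pos (by norm_num)]; simp
  refine ⟨sInf S, ?_, ?_⟩
  · have h1 : 1 / 2 ≤ F (sInf S) := by
      have := (F.right_continuous (sInf S)).mono_left (nhdsWithin_mono _ Set.Ioi_subset_Ici_self)
      exact ge_of_tendsto this (eventually_nhdsWithin_of_forall hgt)
    have h2 : ν (Set.Iic (sInf S)) = μ {x | f x ≤ sInf S} := Measure.map_apply hf measurableSet_Iic
    rw [← h2, ← ProbabilityTheory.ofReal_cdf, ← hhalf]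
    exact ENNReal.ofReal_le_ofReal h1
  · have h2 : ν (Set.Iio (sInf S))ᶜ = μ {x | sInf S ≤ f x} := by
      rw [Set.compl_Iio]; exact Measure.map_apply hf measurableSet_Ici
    have h3 : ν (Set.Iio (sInf S)) ≤ 1 / 2 := by
      rw [← ProbabilityTheory.measure_cdf ν, StieltjesFunction.measure_Iio _ hbot, ← hhalf, sub_zero]
      refine ENNReal.ofReal_le_ofReal (le_of_tendsto (F.mono.tendsto_leftLim _) ?_)
      exact eventually_nhdsWithin_of_forall fun t ht => (hlt t ht).le
    rw [← h2, prob_compl_eq_one_sub measurableSet_Iio]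
    calc (1 / 2 : ℝ≥0∞) = 1 - 1 / 2 := by simp
      _ ≤ _ := tsub_le_tsub_left h3 1

variable {Ω : Type*} [MetricSpace Ω] [MeasurableSpace Ω] [BorelSpace Ω]

/-- Points at distance less than `r / D` from `{f ≤ m}` satisfy `D (f - m) < r`, so the upper tail
lies outside that enlargement. -/
theorem ExpConcentration.measure_le {μ : Measure Ω} [IsProbabilityMeasure μ] {p : ℝ} {D : ℝ≥0}
    (h : ExpConcentration μ p D) (hD : 0 < D) {f : Ω → ℝ} (hf : LipschitzWith 1 f) {m : ℝ}
    (hm : 1 / 2 ≤ μ {x | f x ≤ m}) {r : ℝ} (hr : 0 ≤ r) :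
    μ {x | r ≤ D * (f x - m)} ≤ ENNReal.ofReal (Real.exp (1 - r ^ p)) := by
  have hD' : (0 : ℝ) < D := hD
  have hA : MeasurableSet {x | f x ≤ m} := measurableSet_le hf.continuous.measurable measurable_const
  have h1 := (le_logConcentrationProfile_iff μ (r / D) _).1 (h (r / D) (by positivity)) _ hA hm
  rw [mul_div_cancel₀ _ hD'.ne', ← EReal.coe_neg, EReal.exp_coe, neg_sub] at h1
  rw [← prob_compl_eq_one_sub Metric.isOpen_thickening.measurableSet] at h1
  refine (measure_mono fun x hx hxt => ?_).trans h1
  obtain ⟨y, hy, hxy⟩ := Metric.mem_thickening_iff.1 hxt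
  have h2 : f x ≤ f y + dist x y := by simpa using hf.le_add_mul x y
  have hy : f y ≤ m := hy
  have hx : r ≤ D * (f x - m) := hx
  rw [lt_div_iff₀ hD'] at hxy
  nlinarith

theorem ExpConcentration.exists_measure_abs_le {μ : Measure Ω} [IsProbabilityMeasure μ] {p : ℝ}
    {D : ℝ≥0} (h : ExpConcentration μ p D) (hD : 0 < D) {f : Ω → ℝ} (hf : LipschitzWith 1 f) :
    ∃ m, ∀ r, 0 ≤ r →
      μ {x | r ≤ |D * (f x - m)|} ≤ ENNReal.ofReal (2 * Real.exp (1 - r ^ p)) := by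
  obtain ⟨m, hm1, hm2⟩ := exists_median μ hf.continuous.measurable
  refine ⟨m, fun r hr => ?_⟩
  have h1 := h.measure_le hD hf hm1 hr
  have h2 := h.measure_le hD hf.neg (m := -m) (by simpa using hm2) hr
  rw [two_mul, ENNReal.ofReal_add (by positivity) (by positivity)]
  refine le_trans (measure_mono fun x hx => ?_) ((measure_union_le _ _).trans (add_le_add h1 h2))
  rcases le_abs.1 (show r ≤ |D * (f x - m)| from hx) with h3 | h3
  · exact Or.inl h3
  · right
    simp only [Set.mem_ofPred_eq, Pi.neg_apply]
    linarith

end Concentration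

/-! ### Exponential moments and the entropy inequality -/

section Moments

variable {Ω : Type*} [MeasurableSpace Ω]

/-- Layer-cake formula: the integral is at most `∫₀^∞ e · e^(-t/2) dt = 2e < 6`. -/
theorem lintegral_exp_half_sub_one_le (μ : Measure Ω) {Z : Ω → ℝ} (hZ : Measurable Z)
    (hZ0 : ∀ x, 0 ≤ Z x)
    (htail : ∀ s, 0 < s → μ {x | s ≤ Z x} ≤ ENNReal.ofReal (2 * Real.exp (1 - s))) :
    ∫⁻ x, ENNReal.ofReal (Real.exp (Z x / 2) - 1) ∂μ ≤ 6 := by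
  have hint : ∀ z : ℝ, ∫ t in (0 : ℝ)..z, Real.exp (t / 2) / 2 = Real.exp (z / 2) - 1 := by
    intro z
    simp
  have hlc := lintegral_comp_eq_lintegral_meas_le_mul μ (f := Z)
    (g := fun t => Real.exp (t / 2) / 2)
    (Filter.Eventually.of_forall hZ0) hZ.aemeasurable
    (fun t _ => Continuous.intervalIntegrable (by fun_prop) _ _)
    (Filter.Eventually.of_forall fun t => by positivity)
  simp only [hint] at hlc
  rw [hlc]
  have hexp : ∫ t in Set.Ioi (0 : ℝ), Real.exp 1 * Real.exp (-(1 / 2) * t) = 2 * Real.exp 1 := by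
    rw [integral_const_mul, integral_exp_mul_Ioi (by norm_num)]
    norm_num; ring
  calc ∫⁻ t in Set.Ioi 0, μ {a | t ≤ Z a} * ENNReal.ofReal (Real.exp (t / 2) / 2)
      ≤ ∫⁻ t in Set.Ioi (0 : ℝ), ENNReal.ofReal (Real.exp 1 * Real.exp (-(1 / 2) * t)) := by
        refine setLIntegral_mono (by fun_prop) fun t ht => ?_
        refine (mul_le_mul_left (htail t ht) _).trans ?_
        rw [← ENNReal.ofReal_mul (by positivity)]
        refine ENNReal.ofReal_le_ofReal (le_of_eq ?_)
        have e : 2 * Real.exp (1 - t) * (Real.exp (t / 2) / 2) =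
          Real.exp (1 - t) * Real.exp (t / 2) := by ring
        rw [e, ← Real.exp_add, ← Real.exp_add]
        congr 1; ring
    _ = ENNReal.ofReal (2 * Real.exp 1) := by
        rw [← hexp, ofReal_integral_eq_lintegral_ofReal]
        · exact (integrableOn_exp_mul_Ioi (by norm_num) 0).const_mul _
        · exact Filter.Eventually.of_forall fun t => by positivity
    _ ≤ 6 := by
        rw [show (6 : ℝ≥0∞) = ENNReal.ofReal 6 by simp]
        exact ENNReal.ofReal_le_ofReal (by linarith [Real.exp_one_lt_d9])

/-- Young's inequality: `klFun` and `e^x - 1` are convex conjugates. It follows from `1 + z ≤ e^z`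
at `z = x - log y`. -/
theorem mul_le_klFun_add_exp_sub_one {x y : ℝ} (hy : 0 ≤ y) :
    y * x ≤ InformationTheory.klFun y + (Real.exp x - 1) := by
  rw [InformationTheory.klFun_apply]
  rcases hy.eq_or_lt with rfl | hy
  · simp; positivity
  · have h := Real.add_one_le_exp (x - Real.log y)
    rw [Real.exp_sub, Real.exp_log hy, le_div_iff₀ hy] at h
    linarith

/-- Young's inequality is integrated with `y = dν/dμ`. Stated for lower integrals, it needs no prior
integrability of `X` under `ν`, and thereby yields it. -/
theorem lintegral_ofReal_le_klDiv_add {ν μ : Measure Ω} [IsFiniteMeasure ν] [IsFiniteMeasure μ] {X : Ω → ℝ} (hX : Measurable X) (hX0 : ∀ x, 0 ≤ X x) :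
    ∫⁻ x, ENNReal.ofReal (X x) ∂ν ≤
      InformationTheory.klDiv ν μ + ∫⁻ x, ENNReal.ofReal (Real.exp (X x) - 1) ∂μ := by
  by_cases hac : ν ≪ μ
  swap
  · simp [InformationTheory.klDiv_of_not_ac hac]
  rw [InformationTheory.klDiv_eq_lintegral_klFun_of_ac hac, ← lintegral_add_right _ (by fun_prop),
    ← lintegral_rnDeriv_mul hac (by fun_prop)]
  refine lintegral_mono_ae ?_
  filter_upwards [ν.rnDeriv_lt_top μ] with x hx
  rw [← ENNReal.ofReal_add (InformationTheory.klFun_nonneg ENNReal.toReal_nonneg)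
    (by linarith [Real.add_one_le_exp (X x), hX0 x])]
  nth_rewrite 1 [← ENNReal.ofReal_toReal hx.ne]
  rw [← ENNReal.ofReal_mul ENNReal.toReal_nonneg]
  exact ENNReal.ofReal_le_ofReal (mul_le_klFun_add_exp_sub_one ENNReal.toReal_nonneg)

end Moments

/-! ### Differences of means controlled by entropy -/

section EntropyBounds

variable {Ω : Type*} [MeasurableSpace Ω] {ν μ : Measure Ω} {X : Ω → ℝ} {p : ℝ}

theorem abs_exp_sub_one_sub_id_le_sq_mul_exp (u : ℝ) :
    |Real.exp u - 1 - u| ≤ u ^ 2 * Real.exp |u| := by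
  have h := Complex.norm_exp_sub_sum_le_norm_mul_exp (u : ℂ) 2
  simp only [Finset.sum_range_succ, Finset.sum_range_zero, pow_zero, pow_one, Nat.factorial,
    Complex.norm_real] at h
  have e : Complex.exp u - (0 + 1 / ((1 : ℕ) : ℂ) + (u : ℂ) / (((0 + 1) * 1 : ℕ) : ℂ)) =
      ((Real.exp u - 1 - u : ℝ) : ℂ) := by
    push_cast; ring
  rw [e, Complex.norm_real] at h
  simpa using h

theorem exp_mul_sub_one_le {t : ℝ} (ht0 : 0 ≤ t) (ht1 : t ≤ 1) (x : ℝ) :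
    Real.exp (t * x) - 1 ≤ t * x + 2 * t ^ 2 * Real.exp (2 * |x|) := by
  have h1 := (le_abs_self _).trans (abs_exp_sub_one_sub_id_le_sq_mul_exp (t * x))
  have h2 : Real.exp |t * x| ≤ Real.exp |x| := by
    rw [Real.exp_le_exp, abs_mul, abs_of_nonneg ht0]
    exact mul_le_of_le_one_left (abs_nonneg x) ht1
  have h3 : x ^ 2 ≤ 2 * Real.exp |x| := by
    have := Real.quadratic_le_exp_of_nonneg (abs_nonneg x)
    rw [← sq_abs]
    nlinarith [abs_nonneg x]
  have h4 : (t * x) ^ 2 * Real.exp |t * x| ≤ 2 * t ^ 2 * Real.exp (2 * |x|) := by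
    calc (t * x) ^ 2 * Real.exp |t * x| = t ^ 2 * (x ^ 2 * Real.exp |t * x|) := by ring
      _ ≤ t ^ 2 * (2 * Real.exp |x| * Real.exp |x|) := by gcongr
      _ = 2 * t ^ 2 * Real.exp (2 * |x|) := by rw [two_mul |x|, Real.exp_add]; ring
  linarith

theorem integrable_and_integral_le_of_lintegral_le {ρ : Measure Ω} {g : Ω → ℝ} (hg : Measurable g)
    (hg0 : ∀ x, 0 ≤ g x) {B : ℝ} (hB : 0 ≤ B)
    (h : ∫⁻ x, ENNReal.ofReal (g x) ∂ρ ≤ ENNReal.ofReal B) :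
    Integrable g ρ ∧ ∫ x, g x ∂ρ ≤ B := by
  refine ⟨(lintegral_ofReal_ne_top_iff_integrable hg.aestronglyMeasurable
    (Filter.Eventually.of_forall hg0)).1 (h.trans_lt ENNReal.ofReal_lt_top).ne, ?_⟩
  rw [integral_eq_lintegral_of_nonneg_ae (Filter.Eventually.of_forall hg0) hg.aestronglyMeasurable]
  exact ENNReal.toReal_le_of_le_ofReal hB h

/-- The entropy inequality for `t X`, expanded to second order in `t`: the first-order term is `t`
times the mean under `μ`, which moves to the left. -/
theorem mul_integral_sub_le_klDiv_add [IsProbabilityMeasure ν] [IsProbabilityMeasure μ]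
    (hkl : InformationTheory.klDiv ν μ ≠ ∞) (hXν : Integrable X ν)
    (hXμ : Integrable X μ) (hexp : Integrable (fun x => Real.exp (2 * |X x|)) μ) {t : ℝ}
    (ht0 : 0 ≤ t) (ht1 : t ≤ 1) :
    t * (∫ x, X x ∂ν - ∫ x, X x ∂μ) ≤
      (InformationTheory.klDiv ν μ).toReal + 2 * t ^ 2 * ∫ x, Real.exp (2 * |X x|) ∂μ := by
  obtain ⟨hac, hllr⟩ := InformationTheory.klDiv_ne_top_iff.1 hkl
  have hkf := (InformationTheory.integrable_klFun_rnDeriv_iff hac).2 hllr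
  rw [InformationTheory.toReal_klDiv_eq_integral_klFun hac, ← integral_rnDeriv_smul hac]
  have hρ := (integrable_rnDeriv_smul_iff hac).2 hXν
  have hsum : Integrable (fun x => t * X x + 2 * t ^ 2 * Real.exp (2 * |X x|)) μ :=
    (hXμ.const_mul t).add (hexp.const_mul (2 * t ^ 2))
  have key : ∫ x, t * ((ν.rnDeriv μ x).toReal • X x) ∂μ ≤
      ∫ x, InformationTheory.klFun (ν.rnDeriv μ x).toReal +
        (t * X x + 2 * t ^ 2 * Real.exp (2 * |X x|)) ∂μ := by
    refine integral_mono (hρ.const_mul t) (hkf.add hsum) fun x => ?_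
    have h1 := mul_le_klFun_add_exp_sub_one (x := t * X x)
      (ENNReal.toReal_nonneg (a := ν.rnDeriv μ x))
    have h2 := exp_mul_sub_one_le ht0 ht1 (X x)
    simp only [smul_eq_mul]
    linarith
  have e1 : ∫ x, t * X x + 2 * t ^ 2 * Real.exp (2 * |X x|) ∂μ =
      t * ∫ x, X x ∂μ + 2 * t ^ 2 * ∫ x, Real.exp (2 * |X x|) ∂μ := by
    rw [integral_add (hXμ.const_mul t) (hexp.const_mul (2 * t ^ 2)), integral_const_mul,
      integral_const_mul]
  rw [integral_const_mul, integral_add hkf hsum, e1] at key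
  linarith

/-- For `x ≥ T` this is `x / T ≤ (x / T)^p`. It replaces Hölder's inequality, with constants free of
`p`. -/
theorem le_add_rpow_mul {x T : ℝ} (hp : 1 ≤ p) (hx : 0 ≤ x) (hT : 0 < T) :
    x ≤ T + x ^ p * (T / T ^ p) := by
  rcases le_total x T with h | h
  · have : 0 ≤ x ^ p * (T / T ^ p) := by positivity
    linarith
  · have h1 := Real.self_le_rpow_of_one_le ((one_le_div hT).2 h) hp
    rw [Real.div_rpow hx hT.le, div_le_iff₀ hT] at h1
    calc x ≤ x ^ p / T ^ p * T := h1
      _ = x ^ p * (T / T ^ p) := by ring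
      _ ≤ _ := by linarith

theorem le_one_add_rpow {x : ℝ} (hp : 1 ≤ p) (hx : 0 ≤ x) : x ≤ 1 + x ^ p := by
  simpa using le_add_rpow_mul hp hx one_pos

theorem integral_abs_rpow_le_klDiv [IsFiniteMeasure ν] [IsFiniteMeasure μ] (hX : Measurable X)
    (hexp : ∫⁻ x, ENNReal.ofReal (Real.exp (|X x| ^ p / 2) - 1) ∂μ ≤ 6)
    (hkl : InformationTheory.klDiv ν μ ≠ ∞) :
    Integrable (fun x => |X x| ^ p) ν ∧
      ∫ x, |X x| ^ p ∂ν ≤ 2 * (InformationTheory.klDiv ν μ).toReal + 12 := by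
  have hm : Measurable fun x => |X x| ^ p / 2 := by fun_prop
  have h0 : ∀ x, 0 ≤ |X x| ^ p / 2 := fun x => by positivity
  have h1 := (lintegral_ofReal_le_klDiv_add (ν := ν) hm h0).trans (add_le_add_right hexp _)
  obtain ⟨h2, h3⟩ := integrable_and_integral_le_of_lintegral_le hm h0
    (B := (InformationTheory.klDiv ν μ).toReal + 6) (by positivity) (by
      rwa [ENNReal.ofReal_add ENNReal.toReal_nonneg (by norm_num), ENNReal.ofReal_toReal hkl,
        ENNReal.ofReal_ofNat])
  refine ⟨by simpa using h2.mul_const 2, ?_⟩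
  rw [integral_div] at h3
  linarith

theorem integrable_of_integrable_abs_rpow [IsFiniteMeasure ν] (hp : 1 ≤ p) (hX : Measurable X)
    (h : Integrable (fun x => |X x| ^ p) ν) : Integrable X ν :=
  ((integrable_const 1).add h).mono' hX.aestronglyMeasurable
    (Filter.Eventually.of_forall fun x => le_one_add_rpow hp (abs_nonneg (X x)))

theorem integral_abs_le_of_integral_abs_rpow_le [IsProbabilityMeasure ν] (hp : 1 ≤ p)
    (hX : Measurable X) (h : Integrable (fun x => |X x| ^ p) ν) {T B : ℝ} (hT : 0 < T)
    (hB : ∫ x, |X x| ^ p ∂ν ≤ B * T ^ p) : ∫ x, |X x| ∂ν ≤ (1 + B) * T := by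
  have h1 : ∫ x, |X x| ∂ν ≤ ∫ x, T + |X x| ^ p * (T / T ^ p) ∂ν :=
    integral_mono (integrable_of_integrable_abs_rpow hp hX h).abs
      ((integrable_const T).add (h.mul_const _)) fun x => le_add_rpow_mul hp (abs_nonneg _) hT
  rw [integral_add (integrable_const T) (h.mul_const _), integral_mul_const, integral_const] at h1
  have hTp : 0 < T ^ p := by positivity
  have h2 : (∫ x, |X x| ^ p ∂ν) * (T / T ^ p) ≤ B * T ^ p * (T / T ^ p) := by gcongr
  have h3 : B * T ^ p * (T / T ^ p) = B * T := by field_simp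
  simp at h1
  linarith

theorem integral_sub_le_of_one_le_klDiv [IsProbabilityMeasure ν] [IsProbabilityMeasure μ]
    (hp : 1 ≤ p) (hX : Measurable X)
    (hexp : ∫⁻ x, ENNReal.ofReal (Real.exp (|X x| ^ p / 2) - 1) ∂μ ≤ 6)
    (hkl : InformationTheory.klDiv ν μ ≠ ∞) (hH : 1 ≤ (InformationTheory.klDiv ν μ).toReal) :
    ∫ x, X x ∂ν - ∫ x, X x ∂μ ≤ 28 * (InformationTheory.klDiv ν μ).toReal ^ (1 / p) := by
  set H := (InformationTheory.klDiv ν μ).toReal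
  have hp0 : 0 < p := by linarith
  set T := H ^ (1 / p) with hT
  have hTp : T ^ p = H := by
    rw [hT, ← Real.rpow_mul (by linarith), one_div_mul_cancel hp0.ne', Real.rpow_one]
  have hT1 : 1 ≤ T := Real.one_le_rpow hH (by positivity)
  obtain ⟨hν, hν'⟩ := integral_abs_rpow_le_klDiv hX hexp hkl
  obtain ⟨hμ, hμ'⟩ := integral_abs_rpow_le_klDiv (ν := μ) hX hexp (by simp)
  simp only [InformationTheory.klDiv_self, ENNReal.toReal_zero] at hμ'
  -- Since `H ≥ 1`, `2H + 12 ≤ 14 T^p`, so the mean of `|X|` is at most `15 T` under `ν`. Under `μ`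
  -- the entropy is `0` and the bound is `13 ≤ 13 T`; together `28 T`.
  have h1 := integral_abs_le_of_integral_abs_rpow_le hp hX hν (T := T) (B := 14) (by linarith)
    (by rw [hTp]; linarith)
  have h2 := integral_abs_le_of_integral_abs_rpow_le hp hX hμ (T := 1) (B := 12) one_pos
    (by rw [Real.one_rpow]; linarith)
  have h3 : ∫ x, X x ∂ν ≤ ∫ x, |X x| ∂ν := (le_abs_self _).trans abs_integral_le_integral_abs
  have h4 : -∫ x, X x ∂μ ≤ ∫ x, |X x| ∂μ := (neg_le_abs _).trans abs_integral_le_integral_abs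
  linarith

theorem integral_sub_le_of_klDiv_le_one [IsProbabilityMeasure ν] [IsProbabilityMeasure μ]
    (hp : 1 ≤ p) (hX : Measurable X)
    (hexp : ∫⁻ x, ENNReal.ofReal (Real.exp (|X x| ^ p / 2) - 1) ∂μ ≤ 6)
    (hkl : InformationTheory.klDiv ν μ ≠ ∞) (hH : (InformationTheory.klDiv ν μ).toReal ≤ 1) :
    ∫ x, X x ∂ν - ∫ x, X x ∂μ ≤ 100 * √(InformationTheory.klDiv ν μ).toReal := by
  have hν := integrable_of_integrable_abs_rpow hp hX (integral_abs_rpow_le_klDiv hX hexp hkl).1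
  have hμ := integrable_of_integrable_abs_rpow hp hX
    (integral_abs_rpow_le_klDiv (ν := μ) hX hexp (by simp)).1
  obtain ⟨hei, he6⟩ := integrable_and_integral_le_of_lintegral_le
    (g := fun x => Real.exp (|X x| ^ p / 2) - 1) (B := 6) (by fun_prop)
    (fun x => by
      have := Real.add_one_le_exp (|X x| ^ p / 2)
      have : 0 ≤ |X x| ^ p / 2 := by positivity
      linarith) (by norm_num) (by simpa using hexp)
  have hei' : Integrable (fun x => Real.exp (|X x| ^ p / 2)) μ := by
    refine (hei.add (integrable_const (1 : ℝ))).congr (Filter.Eventually.of_forall fun x => ?_)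
    simp
  rw [integral_sub hei' (integrable_const 1)] at he6
  simp only [integral_const, probReal_univ, smul_eq_mul, mul_one] at he6
  -- Scaling by `4` makes `2 |X / 4| = |X| / 2 ≤ 1/2 + |X|^p / 2`, so the moment is at most `√e · 7
  -- ≤ 12`.
  have hpt : ∀ x, Real.exp (2 * |X x / 4|) ≤ Real.exp (1 / 2) * Real.exp (|X x| ^ p / 2) := by
    intro x
    rw [← Real.exp_add, Real.exp_le_exp, abs_div]
    have := le_one_add_rpow hp (abs_nonneg (X x))
    norm_num
    linarith
  have hexpi : Integrable (fun x => Real.exp (2 * |X x / 4|)) μ :=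
    (hei'.const_mul (Real.exp (1 / 2))).mono' (by fun_prop) (Filter.Eventually.of_forall fun x => by
      simpa using hpt x)
  have hhalf : Real.exp (1 / 2) ≤ 12 / 7 := by
    have h1 : Real.exp (1 / 2) * Real.exp (1 / 2) = Real.exp 1 := by
      rw [← Real.exp_add]; norm_num
    nlinarith [Real.exp_one_lt_d9, Real.exp_pos (1 / 2)]
  have h12 : ∫ x, Real.exp (2 * |X x / 4|) ∂μ ≤ 12 := by
    refine (integral_mono hexpi (hei'.const_mul _) hpt).trans ?_
    rw [integral_const_mul]
    nlinarith [Real.exp_pos (1 / 2)]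
  have key : ∀ t : ℝ, 0 ≤ t → t ≤ 1 → t * (∫ x, X x ∂ν - ∫ x, X x ∂μ) ≤
      4 * (InformationTheory.klDiv ν μ).toReal + 96 * t ^ 2 := by
    intro t ht0 ht1
    have := mul_integral_sub_le_klDiv_add hkl (hν.div_const 4) (hμ.div_const 4) hexpi ht0 ht1
    rw [integral_div, integral_div] at this
    nlinarith [sq_nonneg t]
  set H := (InformationTheory.klDiv ν μ).toReal
  have hH0 : 0 ≤ H := ENNReal.toReal_nonneg
  set Δ := ∫ x, X x ∂ν - ∫ x, X x ∂μ
  -- For `H > 0` take `t = √H`, which is at most `1`. For `H = 0` a small `t` rules out `Δ > 0`: the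
  -- choice below would give `Δ ≤ 96 t ≤ Δ / 2`.
  rcases hH0.eq_or_lt with h0 | h0
  · rw [← h0, Real.sqrt_zero, mul_zero]
    rw [← h0] at key
    by_contra! hΔ
    have ht : 0 < min 1 (Δ / 192) := by positivity
    have h1 := key _ ht.le (min_le_left _ _)
    nlinarith [min_le_right 1 (Δ / 192)]
  · have hs : 0 < √H := Real.sqrt_pos.2 h0
    have h1 := key (√H) hs.le (Real.sqrt_le_one.2 hH)
    have h2 := Real.sq_sqrt hH0
    refine le_of_mul_le_mul_left ?_ hs
    nlinarith

end EntropyBounds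

/-! ### Comparison of `φ_p` with powers -/

section Phi

variable {p : ℝ} {x : ℝ}

theorem rpow_le_of_one_le_phi (hp : 1 ≤ p) (hx : 0 ≤ x) (h : 1 ≤ phi p x) :
    phi p x ^ (1 / p) ≤ x := by
  have hp0 : 0 < p := by linarith
  have hxp : 0 ≤ x ^ p := by positivity
  have hle : phi p x ≤ x ^ p := by
    unfold phi at h ⊢
    split_ifs at h ⊢ with h2 h1
    · exact div_le_self hxp hp
    · nlinarith
    · have : x ^ p / p ≤ x ^ p := div_le_self hxp hp
      have h3 : 1 / 2 ≤ 1 / p := by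
        rw [div_le_div_iff₀ two_pos hp0]; linarith
      linarith
  rw [one_div]
  exact (Real.rpow_inv_le_iff_of_pos (phi_nonneg hp hx) hx hp0).2 hle

theorem sqrt_phi_le (hp : 1 ≤ p) (hx : 0 ≤ x) (h : phi p x ≤ 1) : √(phi p x) ≤ x := by
  have hp0 : 0 < p := by linarith
  rw [Real.sqrt_le_left hx]
  rcases le_or_gt 1 x with h1 | h1
  · nlinarith
  unfold phi
  split_ifs with h2
  · have h3 : x ^ p ≤ x ^ (2 : ℝ) := Real.rpow_le_rpow_of_exponent_ge_of_imp hx h1.le h2 fun _ h => by linarith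
    rw [Real.rpow_two] at h3
    exact (div_le_self (by positivity) hp).trans h3
  · nlinarith [sq_nonneg x]
  · linarith

/-- The factor `1 + p` lost in `x^p ≤ (1 + p) (φ_p(x) + 1)` is at most `2^p` by Bernoulli, so it
costs only `2` after taking `p`-th roots. -/
theorem le_two_mul_phi_rpow_add_one (hp : 1 ≤ p) (hx : 0 ≤ x) :
    x ≤ 2 * (phi p x ^ (1 / p) + 1) := by
  have hp0 : 0 < p := by linarith
  have hφ := phi_nonneg hp hx
  by_cases hx1 : x ≤ 1
  · have : 0 ≤ phi p x ^ (1 / p) := by positivity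
    linarith
  have h1 : x ^ p ≤ (1 + p) * (phi p x + 1) := by
    have e : x ^ p / p * p = x ^ p := div_mul_cancel₀ _ hp0.ne'
    by_cases h2 : 2 ≤ p
    · have : phi p x = x ^ p / p := by rw [phi, if_pos h2]
      rw [← this] at e
      nlinarith
    · have : phi p x = x ^ p / p + 1 / 2 - 1 / p := by rw [phi, if_neg h2, if_neg hx1]
      have e2 : x ^ p / p = phi p x - 1 / 2 + 1 / p := by linarith
      have e3 : 1 / p * p = 1 := by field_simp
      rw [e2] at e
      nlinarith
  have h2 : 1 + p ≤ 2 ^ p := by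
    have := one_add_mul_self_le_rpow_one_add (s := 1) (by norm_num) hp
    norm_num at this
    linarith
  have h3 : phi p x + 1 ≤ (phi p x ^ (1 / p) + 1) ^ p := by
    have := Real.add_rpow_le_rpow_add (a := phi p x ^ (1 / p)) (b := 1) (by positivity)
      zero_le_one hp
    rwa [← Real.rpow_mul hφ, one_div_mul_cancel hp0.ne', Real.rpow_one, Real.one_rpow] at this
  have h4 : 0 ≤ phi p x ^ (1 / p) := by positivity
  refine (Real.rpow_le_rpow_iff hx (by positivity) hp0).1 ?_
  rw [Real.mul_rpow two_pos.le (by linarith)]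
  calc x ^ p ≤ (1 + p) * (phi p x + 1) := h1
    _ ≤ _ := by gcongr

end Phi

/-! ### The implications between the three inequalities -/

theorem TightTransportEntropy.weakTransportEntropy {Ω : Type*} [MetricSpace Ω]
    [MeasurableSpace Ω] {μ : Measure Ω} {p : ℝ} {D : ℝ≥0} (h : TightTransportEntropy μ p D)
    (hp : 1 ≤ p) : WeakTransportEntropy μ p (1 / 2 * D) := by
  intro ν hν
  have hp0 : 0 < 1 / p := by positivity
  have h1 := h ν hν
  rcases eq_or_ne (InformationTheory.klDiv ν μ) ∞ with hkl | hkl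
  · simp [hkl, ENNReal.top_rpow_of_pos (inv_pos.1 (by simpa using hp0 : 0 < p⁻¹⁻¹))]
  obtain ⟨x, hx⟩ := exists_phi_eq hp (InformationTheory.klDiv ν μ).toNNReal
  have hx' : phi p x = (InformationTheory.klDiv ν μ).toReal := hx
  have hinv : phiInv p (InformationTheory.klDiv ν μ) = x := by
    rw [← phiInv_phi hp x, hx', ENNReal.ofReal_toReal hkl]
  have h2 := le_two_mul_phi_rpow_add_one hp x.2
  simp only [NNReal.val_eq_coe, hx] at h2
  have h3 : x ≤ 2 * ((InformationTheory.klDiv ν μ).toNNReal ^ (1 / p) + 1) := by exact_mod_cast h2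
  rw [hinv] at h1
  calc ((1 / 2 * D : ℝ≥0) : ℝ≥0∞) * wasserstein₁ ν μ
      = ((1 / 2 : ℝ≥0) : ℝ≥0∞) * (D * wasserstein₁ ν μ) := by rw [ENNReal.coe_mul, mul_assoc]
    _ ≤ ((1 / 2 : ℝ≥0) : ℝ≥0∞) *
          ((2 * ((InformationTheory.klDiv ν μ).toNNReal ^ (1 / p) + 1) : ℝ≥0) : ℝ≥0∞) := by
        gcongr
        exact h1.trans (by exact_mod_cast h3)
    _ = (((InformationTheory.klDiv ν μ).toNNReal ^ (1 / p) + 1 : ℝ≥0) : ℝ≥0∞) := by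
        rw [← ENNReal.coe_mul]
        congr 1
        field_simp
    _ = InformationTheory.klDiv ν μ ^ (1 / p) + 1 := by
        rw [ENNReal.coe_add, ENNReal.coe_rpow_of_nonneg _ hp0.le, ENNReal.coe_toNNReal hkl]
        rfl

/-- The density of the conditioned measure is constant on `A`, equal to `1 / μ(A)`. -/
theorem klDiv_cond_le {Ω : Type*} [MeasurableSpace Ω] {μ : Measure Ω} [IsProbabilityMeasure μ]
    {A : Set Ω} (hA : MeasurableSet A) (hA0 : μ A ≠ 0) :
    InformationTheory.klDiv (ProbabilityTheory.cond μ A) μ ≤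
      ENNReal.ofReal (-Real.log (μ.real A)) := by
  have hprob := ProbabilityTheory.cond_isProbabilityMeasure hA0
  have hac : ProbabilityTheory.cond μ A ≪ μ := ProbabilityTheory.cond_absolutelyContinuous
  have hllr : llr (ProbabilityTheory.cond μ A) μ =ᵐ[ProbabilityTheory.cond μ A]
      fun _ => -Real.log (μ.real A) := by
    have h1 : (ProbabilityTheory.cond μ A).rnDeriv μ =ᵐ[μ]
        fun x => (μ A)⁻¹ * A.indicator 1 x := by
      filter_upwards [Measure.rnDeriv_smul_left_of_ne_top (μ.restrict A) μ (ENNReal.inv_ne_top.2 hA0),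
        Measure.rnDeriv_restrict_self μ hA] with x hx1 hx2
      rw [ProbabilityTheory.cond, hx1, Pi.smul_apply, hx2, smul_eq_mul]
    filter_upwards [hac.ae_le h1, ProbabilityTheory.ae_cond_mem hA] with x hx hxA
    rw [llr, hx, Set.indicator_of_mem hxA, Pi.one_apply, mul_one, ENNReal.toReal_inv, Real.log_inv]
    rfl
  rw [InformationTheory.klDiv_of_ac_of_integrable hac ((integrable_const _).congr hllr.symm),
    integral_congr_ae hllr]
  simp

variable {Ω : Type*} [MetricSpace Ω] [MeasurableSpace Ω] [BorelSpace Ω]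
  {ν μ : Measure Ω} {p : ℝ} {D : ℝ≥0}

/-- `B` stands for `φ_p⁻¹(H)`; only its domination of `H^(1/p)` for `H ≥ 1` and of `√H` for `H ≤ 1`
matters. -/
theorem ExpConcentration.integrable_and_integral_sub_le [IsProbabilityMeasure ν]
    [IsProbabilityMeasure μ] (h : ExpConcentration μ p D) (hp : 1 ≤ p) (hD : 0 < D)
    (hkl : InformationTheory.klDiv ν μ ≠ ∞) {f : Ω → ℝ} (hf : LipschitzWith 1 f) {B : ℝ}
    (hB1 : 1 ≤ (InformationTheory.klDiv ν μ).toReal →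
      (InformationTheory.klDiv ν μ).toReal ^ (1 / p) ≤ B)
    (hB2 : (InformationTheory.klDiv ν μ).toReal ≤ 1 →
      √(InformationTheory.klDiv ν μ).toReal ≤ B) :
    Integrable f ν ∧ Integrable f μ ∧ D * (∫ x, f x ∂ν - ∫ x, f x ∂μ) ≤ 100 * B := by
  have hp0 : 0 < p := by linarith
  have hD' : (0 : ℝ) < D := hD
  obtain ⟨m, hm⟩ := h.exists_measure_abs_le hD hf
  set X : Ω → ℝ := fun x => D * (f x - m) with hX
  have hXm : Measurable X := (hf.continuous.measurable.sub_const m).const_mul _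
  have hexp : ∫⁻ x, ENNReal.ofReal (Real.exp (|X x| ^ p / 2) - 1) ∂μ ≤ 6 := by
    refine lintegral_exp_half_sub_one_le μ (by fun_prop) (fun x => by positivity) fun s hs => ?_
    have h1 := hm (s ^ p⁻¹) (by positivity)
    rw [Real.rpow_inv_rpow hs.le hp0.ne'] at h1
    refine (measure_mono fun x hx => ?_).trans h1
    exact (Real.rpow_inv_le_iff_of_pos hs.le (abs_nonneg _) hp0).2 hx
  have hint : ∀ ρ : Measure Ω, IsProbabilityMeasure ρ → InformationTheory.klDiv ρ μ ≠ ∞ →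
      Integrable f ρ ∧ ∫ x, X x ∂ρ = D * (∫ x, f x ∂ρ - m) := by
    intro ρ _ hρ
    have h1 := integrable_of_integrable_abs_rpow hp hXm (integral_abs_rpow_le_klDiv hXm hexp hρ).1
    have h2 : Integrable f ρ := by
      refine ((h1.div_const D).add (integrable_const m)).congr
        (Filter.Eventually.of_forall fun x => ?_)
      simp only [hX, Pi.add_apply]
      field_simp
      ring
    refine ⟨h2, ?_⟩
    rw [integral_const_mul, integral_sub h2 (integrable_const m)]
    simp
  obtain ⟨hν1, hν2⟩ := hint ν inferInstance hkl
  obtain ⟨hμ1, hμ2⟩ := hint μ inferInstance (by simp)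
  have e : ↑D * (∫ x, f x ∂ν - ∫ x, f x ∂μ) = ∫ x, X x ∂ν - ∫ x, X x ∂μ := by
    rw [hν2, hμ2]; ring
  refine ⟨hν1, hμ1, ?_⟩
  rw [e]
  rcases le_total 1 (InformationTheory.klDiv ν μ).toReal with hH | hH
  · have h1 := integral_sub_le_of_one_le_klDiv hp hXm hexp hkl hH
    have h2 := hB1 hH
    have h3 : 0 ≤ (InformationTheory.klDiv ν μ).toReal ^ (1 / p) := by positivity
    linarith
  · have h1 := integral_sub_le_of_klDiv_le_one hp hXm hexp hkl hH
    linarith [hB2 hH]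

theorem ExpConcentration.tightTransportEntropy [TopologicalSpace.SeparableSpace Ω]
    [IsProbabilityMeasure μ] (h : ExpConcentration μ p D) (hp : 1 ≤ p) :
    TightTransportEntropy μ p (1 / 100 * D) := by
  intro ν _
  rcases eq_or_ne (InformationTheory.klDiv ν μ) ∞ with hkl | hkl
  · rw [hkl, phiInv_top]; exact le_top
  rcases eq_zero_or_pos D with rfl | hD
  · simp
  obtain ⟨x, hx⟩ := exists_phi_eq hp (InformationTheory.klDiv ν μ).toNNReal
  have hx' : phi p x = (InformationTheory.klDiv ν μ).toReal := hx
  have hinv : phiInv p (InformationTheory.klDiv ν μ) = x := by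
    rw [← phiInv_phi hp x, hx', ENNReal.ofReal_toReal hkl]
  have key := fun (f : Ω → ℝ) (hf : LipschitzWith 1 f) =>
    h.integrable_and_integral_sub_le (ν := ν) hp hD hkl hf (B := x)
      (fun hH => by rw [← hx'] at hH ⊢; exact rpow_le_of_one_le_phi hp x.2 hH)
      (fun hH => by rw [← hx'] at hH ⊢; exact sqrt_phi_le hp x.2 hH)
  obtain ⟨x₀⟩ : Nonempty Ω := μ.nonempty_of_neZero
  -- Distance to a point, itself `1`-Lipschitz, supplies the finite first moments that duality
  -- requires.
  have hd := key (fun y => dist y x₀) (LipschitzWith.dist_left x₀)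
  have hD' : (0 : ℝ) < D := hD
  have hW : wasserstein₁ ν μ ≤ ENNReal.ofReal ((100 * x / D : ℝ≥0) : ℝ) := by
    refine transportCost_edist_le_of_lipschitz hd.1 hd.2.1 fun f hf => ?_
    push_cast
    rw [le_div_iff₀ hD', mul_comm]
    exact (key f hf).2.2
  rw [hinv]
  calc ((1 / 100 * D : ℝ≥0) : ℝ≥0∞) * wasserstein₁ ν μ
      ≤ ((1 / 100 * D : ℝ≥0) : ℝ≥0∞) * ((100 * x / D : ℝ≥0) : ℝ≥0∞) := by
        rw [ENNReal.ofReal_coe_nnreal] at hW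
        gcongr
    _ = x := by
        rw [← ENNReal.coe_mul]
        congr 1
        field_simp

/-- The easy half of duality: integrate `f x - f y ≤ d(x, y)` against any coupling. -/
theorem ofReal_integral_sub_le_wasserstein₁ {f : Ω → ℝ} (hf : LipschitzWith 1 f)
    (hν : Integrable f ν) (hμ : Integrable f μ) :
    ENNReal.ofReal (∫ x, f x ∂ν - ∫ x, f x ∂μ) ≤ wasserstein₁ ν μ := by
  refine le_iInf₂ fun π hπ => ?_
  obtain ⟨_, rfl, rfl⟩ := hπ
  have hfm := hf.continuous.measurable
  have h1 : Integrable (fun z : Ω × Ω => f z.1) π := hν.comp_measurable measurable_fst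
  have h2 : Integrable (fun z : Ω × Ω => f z.2) π := hμ.comp_measurable measurable_snd
  rw [Measure.fst, Measure.snd, integral_map measurable_fst.aemeasurable hfm.aestronglyMeasurable,
    integral_map measurable_snd.aemeasurable hfm.aestronglyMeasurable, ← integral_sub h1 h2]
  refine (Real.ofReal_le_enorm _).trans ((enorm_integral_le_lintegral_enorm _).trans
    (lintegral_mono fun z => ?_))
  rw [← edist_eq_enorm_sub]
  simpa using hf z.1 z.2

theorem WeakTransportEntropy.expConcentration [IsProbabilityMeasure μ]
    (h : WeakTransportEntropy μ p D) (hp : 1 ≤ p) : ExpConcentration μ p (1 / 4 * D) := by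
  intro r hr
  have hp0 : 0 < p := by linarith
  rw [le_logConcentrationProfile_iff]
  intro A hA hA2
  rw [← EReal.coe_neg, EReal.exp_coe, neg_sub]
  have hopen : IsOpen (Metric.thickening r A) := Metric.isOpen_thickening
  rw [← prob_compl_eq_one_sub hopen.measurableSet]
  set B := (Metric.thickening r A)ᶜ with hB
  have hBm : MeasurableSet B := hopen.measurableSet.compl
  set s : ℝ := ((1 / 4 * D : ℝ≥0) : ℝ) * r with hs
  have hs0 : 0 ≤ s := by positivity
  have hDs : D * r = 4 * s := by rw [hs]; push_cast; ring
  -- For `s ≤ 1` the required bound `exp(1 - s^p)` is at least `1`.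
  rcases le_or_gt s 1 with hs1 | hs1
  · refine prob_le_one.trans ?_
    rw [← ENNReal.ofReal_one]
    refine ENNReal.ofReal_le_ofReal (Real.one_le_exp ?_)
    linarith [Real.rpow_le_one hs0 hs1 hp0.le]
  rcases eq_or_ne (μ B) 0 with hB0 | hB0
  · simp [hB0]
  have hA0 : μ A ≠ 0 := fun h0 => by simp [h0] at hA2
  have hAne : A.Nonempty := nonempty_of_measure_ne_zero hA0
  have hpA := ProbabilityTheory.cond_isProbabilityMeasure hA0
  have hpB := ProbabilityTheory.cond_isProbabilityMeasure hB0
  -- The distance to `A`, cut off at `r`: it is `0` on `A` and `r` on `B`, and bounded, so no moment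
  -- assumption is needed.
  set f : Ω → ℝ := fun x => min (Metric.infDist x A) r with hf
  have hL : LipschitzWith 1 f := (Metric.lipschitz_infDist_pt A).min_const r
  have hint : ∀ ρ : Measure Ω, IsProbabilityMeasure ρ → Integrable f ρ := fun ρ _ =>
    (integrable_const r).mono' hL.continuous.measurable.aestronglyMeasurable
      (Filter.Eventually.of_forall fun x => by
        rw [Real.norm_eq_abs, abs_of_nonneg (le_min Metric.infDist_nonneg hr)]
        exact min_le_right _ _)
  have hfA : ∫ x, f x ∂(ProbabilityTheory.cond μ A) = 0 := by
    refine integral_eq_zero_of_ae ?_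
    filter_upwards [ProbabilityTheory.ae_cond_mem hA] with x hx
    simp [hf, Metric.infDist_zero_of_mem hx, hr]
  have hfB : ∫ x, f x ∂(ProbabilityTheory.cond μ B) = r := by
    have : f =ᵐ[ProbabilityTheory.cond μ B] fun _ => r := by
      filter_upwards [ProbabilityTheory.ae_cond_mem hBm] with x hx
      refine min_eq_right (not_lt.1 fun hlt => hx ?_)
      exact (Metric.mem_thickening_iff_infDist_lt hAne).2 hlt
    rw [integral_congr_ae this]; simp
  -- Testing with `-f` on the `A` side and `f` on the `B` side, the unknown mean of `f` under `μ`
  -- cancels in the sum and leaves `r`.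
  have hWA := ofReal_integral_sub_le_wasserstein₁ hL.neg (hint _ hpA).neg (hint μ inferInstance).neg
  have hWB := ofReal_integral_sub_le_wasserstein₁ hL (hint _ hpB) (hint μ inferInstance)
  simp only [Pi.neg_apply, integral_neg, hfA] at hWA
  rw [hfB] at hWB
  set L := -Real.log (μ.real B) with hLdef
  have hBpos : 0 < μ.real B := ENNReal.toReal_pos hB0 (measure_ne_top _ _)
  have hL0 : 0 ≤ L := by
    have := Real.log_nonpos hBpos.le measureReal_le_one
    linarith
  have hklA : InformationTheory.klDiv (ProbabilityTheory.cond μ A) μ ≤ 1 := by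
    refine (klDiv_cond_le hA hA0).trans ?_
    rw [← ENNReal.ofReal_one]
    refine ENNReal.ofReal_le_ofReal ?_
    have h1 : (1 / 2 : ℝ) ≤ μ.real A := by
      have := ENNReal.toReal_mono (measure_ne_top μ A) hA2
      simpa [Measure.real] using this
    have h2 := Real.log_le_log (by norm_num) h1
    rw [one_div, Real.log_inv] at h2
    linarith [Real.log_two_lt_d9]
  have hklB := klDiv_cond_le hBm hB0
  have hinvp : 0 ≤ 1 / p := by positivity
  -- The `3` collects the two additive `1`s of the weak inequality and the entropy term of `A`, at
  -- most `1` because `log 2 ≤ 1`.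
  have hfinal : ENNReal.ofReal (4 * s) ≤ ENNReal.ofReal (L ^ (1 / p) + 3) := by
    calc ENNReal.ofReal (4 * s)
        = D * ENNReal.ofReal r := by
          rw [← hDs, ENNReal.ofReal_mul D.coe_nonneg, ENNReal.ofReal_coe_nnreal]
      _ = D * ENNReal.ofReal ((-0 - -∫ x, f x ∂μ) + (r - ∫ x, f x ∂μ)) := by congr 2; ring
      _ ≤ D * (wasserstein₁ (ProbabilityTheory.cond μ A) μ +
            wasserstein₁ (ProbabilityTheory.cond μ B) μ) := by
          gcongr
          exact ENNReal.ofReal_add_le.trans (add_le_add hWA hWB)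
      _ ≤ ((1 : ℝ≥0∞) ^ (1 / p) + 1) + (ENNReal.ofReal L ^ (1 / p) + 1) := by
          rw [mul_add]
          refine add_le_add ((h _ hpA).trans ?_) ((h _ hpB).trans ?_)
          · gcongr
          · gcongr
      _ = ENNReal.ofReal (L ^ (1 / p) + 3) := by
          rw [ENNReal.one_rpow, ENNReal.ofReal_rpow_of_nonneg hL0 hinvp,
            ENNReal.ofReal_add (by positivity) (by norm_num), ENNReal.ofReal_ofNat]
          ring
  rw [ENNReal.ofReal_le_ofReal_iff (by positivity)] at hfinal
  -- As `s > 1`, `s < 4s - 3 ≤ L^(1/p)`; hence the loss of the factor `4` in the constant.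
  have hsL : s ^ p ≤ L := by
    have h1 : s ≤ L ^ p⁻¹ := by rw [← one_div]; linarith
    exact (Real.le_rpow_inv_iff_of_pos hs0 hL0 hp0).1 h1
  rw [← ofReal_measureReal]
  refine ENNReal.ofReal_le_ofReal ?_
  rw [← Real.exp_log hBpos, Real.exp_le_exp]
  linarith

/-! ### Best constants and the main theorem -/

theorem mul_bestConstant_le {P Q : ℝ≥0 → Prop} {k : ℝ≥0} (h : ∀ D, P D → Q (k * D)) :
    k * bestConstant P ≤ bestConstant Q := by
  simp only [bestConstant, ENNReal.mul_iSup]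
  refine iSup₂_le fun D hD => ?_
  rw [← ENNReal.coe_mul]
  exact le_iSup₂_of_le (k * D) (h D hD) le_rfl

theorem bestConstant_le_mul {P Q : ℝ≥0 → Prop} {k : ℝ≥0} (hk : k ≠ 0)
    (h : ∀ D, P D → Q (k⁻¹ * D)) : bestConstant P ≤ k * bestConstant Q := by
  have h1 : k⁻¹ * bestConstant P ≤ bestConstant Q := by
    simpa using mul_bestConstant_le h
  calc bestConstant P = k * (k⁻¹ * bestConstant P) := by
        rw [← mul_assoc, ← ENNReal.coe_mul, mul_inv_cancel₀ hk, ENNReal.coe_one, one_mul]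
    _ ≤ _ := by gcongr

end TransportConcentration

theorem mainTheorem3 :
    ∃ c C : ℝ≥0, 0 < c ∧ 0 < C ∧
      ∀ (Ω : Type*) [MetricSpace Ω] [CompleteSpace Ω] [TopologicalSpace.SeparableSpace Ω]
        [MeasurableSpace Ω] [BorelSpace Ω] (μ : Measure Ω) [IsProbabilityMeasure μ]
        (p : ℝ), 1 ≤ p →
        ((∃ D, 0 < D ∧ TransportConcentration.ExpConcentration μ p D) ↔
          (∃ D, 0 < D ∧ TransportConcentration.WeakTransportEntropy μ p D)) ∧
        ((∃ D, 0 < D ∧ TransportConcentration.WeakTransportEntropy μ p D) ↔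
          (∃ D, 0 < D ∧ TransportConcentration.TightTransportEntropy μ p D)) ∧
        (c * TransportConcentration.bestConstant
              (TransportConcentration.WeakTransportEntropy μ p) ≤
            TransportConcentration.bestConstant
              (TransportConcentration.ExpConcentration μ p) ∧
          TransportConcentration.bestConstant
              (TransportConcentration.ExpConcentration μ p) ≤
            C * TransportConcentration.bestConstant
              (TransportConcentration.WeakTransportEntropy μ p)) ∧
        (c * TransportConcentration.bestConstant
              (TransportConcentration.TightTransportEntropy μ p) ≤
            TransportConcentration.bestConstant
              (TransportConcentration.WeakTransportEntropy μ p) ∧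
          TransportConcentration.bestConstant
              (TransportConcentration.WeakTransportEntropy μ p) ≤
            C * TransportConcentration.bestConstant
              (TransportConcentration.TightTransportEntropy μ p)) := by
  -- `1/4` is the loss from weak to concentration and also covers the `1/2` from tight to weak. `400
  -- = 4 · 100` is the loss from weak to tight through concentration and covers `200 = 2 · 100` from
  -- concentration to weak.
  refine ⟨1 / 4, 400, by norm_num, by norm_num, fun Ω _ _ _ _ _ μ _ p hp => ?_⟩
  have hCT := fun D (h : TransportConcentration.ExpConcentration μ p D) =>
    h.tightTransportEntropy hp
  have hTW := fun D (h : TransportConcentration.TightTransportEntropy μ p D) =>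
    h.weakTransportEntropy hp
  have hWC := fun D (h : TransportConcentration.WeakTransportEntropy μ p D) =>
    h.expConcentration hp
  have hCW := fun D (h : TransportConcentration.ExpConcentration μ p D) => hTW _ (hCT D h)
  have hWT := fun D (h : TransportConcentration.WeakTransportEntropy μ p D) => hCT _ (hWC D h)
  refine ⟨⟨fun ⟨D, hD, h⟩ => ⟨_, by positivity, hCW D h⟩,
    fun ⟨D, hD, h⟩ => ⟨_, by positivity, hWC D h⟩⟩,
    ⟨fun ⟨D, hD, h⟩ => ⟨_, by positivity, hWT D h⟩,
    fun ⟨D, hD, h⟩ => ⟨_, by positivity, hTW D h⟩⟩,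
    ⟨TransportConcentration.mul_bestConstant_le hWC, ?_⟩, ?_, ?_⟩
  · refine (TransportConcentration.bestConstant_le_mul (k := 200) (by norm_num) fun D h => ?_).trans
      (mul_le_mul_left (by norm_num) _)
    convert hCW D h using 1
    rw [← mul_assoc]; norm_num
  · refine le_trans (mul_le_mul_left ?_ _) (TransportConcentration.mul_bestConstant_le hTW)
    exact ENNReal.coe_le_coe.2 (by rw [← NNReal.coe_le_coe]; norm_num)
  · refine TransportConcentration.bestConstant_le_mul (by norm_num) fun D h => ?_
    convert hWT D h using 1
    rw [← mul_assoc]; norm_num
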